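/- **Theorem (exponential decay of ILW-system solitary waves).** Let $\gamma\in(0,1)$, $\beta>1$ and $\mu,\mu_2,\epsilon>0$. Let $\mathcal W$ and $\mathcal Z$ be the Fourier multiplier operators $$\mathcal W=1+\frac{\beta}{\gamma}\sqrt{\mu}\,|D|\coth(\sqrt{\mu_2}|D|),\qquad \mathcal Z=\frac1\gamma\Big(1+\frac{\beta-1}{\gamma}\sqrt{\mu}\,|D|\coth(\sqrt{\mu_2}|D|)\Big),$$ where $|D|\coth(\sqrt{\mu_2}|D|)$ has the symbol $|y|\coth(\sqrt{\mu_2}|y|)$ in the frequency variable $y$. Put $$\theta=\frac{\gamma\sqrt{\mu_2}}{(\beta-1)\sqrt{\mu}}.$$ Then the equation $-\eta=\theta\tan\eta$ has a smallest positive root $\eta_1$, and the following holds. Let $c\in\mathbb R$ be a speed with $$c^2<\frac{(1-\gamma)(\beta-1)}{\gamma\beta},$$ and let real-valued functions $(\xi,\nu)\in H^1(\mathbb R)\times H^1(\mathbb R)$ (identified with their continuous representatives) solve the solitary-wave system $$-c\,\mathcal W\xi+\mathcal Z\nu=\frac{\epsilon}{\gamma}\,\xi\nu,\qquad \xi=\frac{1}{1-\gamma}\Big(c\,\nu+\frac{\epsilon}{2\gamma}\,\nu^2\Big).$$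 Then there is a constant $N_1>0$ such that for all $x\in\mathbb R$ $$e^{\frac{\eta_1}{\sqrt{\mu_2}}|x|}\,|\xi(x)|\le N_1\qquad\text{and}\qquad e^{\frac{\eta_1}{\sqrt{\mu_2}}|x|}\,|\nu(x)|\le N_1 .$$ (In particular this applies to the even solitary waves of speed $c$ near $0$ that are obtained, for large $\mu_2$, by continuation in $c$ from the wave with $c=0$.) -/

import Mathlib

open MeasureTheory FourierTransform
open scoped SchwartzMap

namespace ILW

/-- `f` is the continuous representative of a real-valued element of the Sobolev space `H¹(ℝ)`. -/
def MemH1 (f : ℝ → ℝ) : Prop :=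
  Continuous f ∧ ∃ hf : MemLp (fun x => (f x : ℂ)) 2 (volume : Measure ℝ),
    TemperedDistribution.MemSobolev 1 2 ((hf.toLp (fun x => (f x : ℂ))) : 𝓢'(ℝ, ℂ))

/-- `g = m(D) f` in `L²(ℝ)`, where `m(D)` is the Fourier multiplier operator whose symbol is `m`
as a function of the angular frequency (`D = -i d/dx`, so that `|D| = H ∂ₓ` has the symbol `|y|`).
Mathlib's Fourier transform uses the kernel `exp (-2 π i x y)`, so its frequency variable `y`
corresponds to the angular frequency `2 π y`. -/
def IsMultiplier (m : ℝ → ℝ) (f g : ℝ → ℝ) : Prop :=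
  ∃ (hf : MemLp (fun x => (f x : ℂ)) 2 (volume : Measure ℝ))
    (hg : MemLp (fun x => (g x : ℂ)) 2 (volume : Measure ℝ)),
    ∀ᵐ y : ℝ, (𝓕 (hg.toLp (fun x => (g x : ℂ))) : Lp ℂ 2 (volume : Measure ℝ)) y =
      (m (2 * Real.pi * y) : ℂ) *
        (𝓕 (hf.toLp (fun x => (f x : ℂ))) : Lp ℂ 2 (volume : Measure ℝ)) y

/-- The symbol `|y| coth (√μ₂ |y|)` of `|D| coth (√μ₂ |D|)`, with its limit `1 / √μ₂` at `y = 0`. -/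
noncomputable def dispSymbol (μ₂ y : ℝ) : ℝ :=
  if y = 0 then 1 / √μ₂ else |y| * (Real.cosh (√μ₂ * |y|) / Real.sinh (√μ₂ * |y|))

/-- The symbol of `𝒲 = 1 + (β/γ) √μ |D| coth (√μ₂ |D|)`. -/
noncomputable def symbolW (γ β μ μ₂ y : ℝ) : ℝ :=
  1 + β / γ * √μ * dispSymbol μ₂ y

/-- The symbol of `𝒵 = (1/γ) (1 + ((β-1)/γ) √μ |D| coth (√μ₂ |D|))`. -/
noncomputable def symbolZ (γ β μ μ₂ y : ℝ) : ℝ :=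
  1 / γ * (1 + (β - 1) / γ * √μ * dispSymbol μ₂ y)

/-- `(ξ, ν) ∈ H¹(ℝ) × H¹(ℝ)` is a solitary-wave profile of speed `c` of the ILW system:
`-c 𝒲 ξ + 𝒵 ν = (ε/γ) ξ ν` in `L²(ℝ)` and `ξ = (1/(1-γ)) (c ν + (ε/(2γ)) ν²)`.
The functions `w = 𝒲 ξ` and `z = 𝒵 ν` in `L²(ℝ)` exist for all `ξ, ν ∈ H¹(ℝ)`, since the symbols
are even and grow at most linearly. -/
structure IsSolitaryWave (γ β μ μ₂ ε c : ℝ) (ξ ν : ℝ → ℝ) : Prop where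
  memH1_ξ : MemH1 ξ
  memH1_ν : MemH1 ν
  first_eq : ∃ w z : ℝ → ℝ,
    IsMultiplier (symbolW γ β μ μ₂) ξ w ∧ IsMultiplier (symbolZ γ β μ μ₂) ν z ∧
      ∀ᵐ x : ℝ, -c * w x + z x = ε / γ * (ξ x * ν x)
  second_eq : ∀ x : ℝ, ξ x = 1 / (1 - γ) * (c * ν x + ε / (2 * γ) * ν x ^ 2)

/-- `η₁` is the first positive root of `-η = θ tan η`. -/
def IsFirstRoot (θ η₁ : ℝ) : Prop :=
  IsLeast {η : ℝ | 0 < η ∧ Real.cos η ≠ 0 ∧ -η = θ * Real.tan η} η₁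

end ILW

/-! # Exponential decay of solitary waves of the ILW system

Eliminating `ξ` turns the system into a scalar equation for `ν`. Write `s` for the symbol
`|y| coth (√μ₂ |y|)` and `T` for the multiplier operator with symbol `1 / (κ + s)`, where `κ` is a
constant with `κ ≥ γ / ((β - 1) √μ)`; this is where the bound on `c ^ 2` enters. Then
`ν - k ν² = T q` with `|q| ≤ C ν²` (`IsSolitaryWave.exists_reduced`). Since `ν ∈ H¹(ℝ)` vanishes at
infinity, `ν` is controlled there by `T q`, and the decay of `ν` follows from a comparison argument
that needs no formula or estimate for the convolution kernel of `T`. There are two ingredients.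

* `T` preserves positivity (`isPositiveMultiplier_one_div_add_dispSymbol`). By the Mittag-Leffler
  expansion of the cotangent, `s(y) = 1/h + (2/h) ∑ y² / (y² + α_n²)` with `h = √μ₂` and
  `α_n = (n + 1) π / h`. A partial sum has the form `C - j`, where `j` is a combination with
  nonnegative coefficients of the symbols `1 / (y² + α_n²)` of convolutions with positive
  exponentials, and `1 / (κ + C - j)` is a Neumann series in `j`.
* For `0 < a < α_0`, the same expansion shows that `κ + |D| coth (h |D|)` maps `exp (-a |x|)` to
  `(κ + a cot (a h)) exp (-a |x|)` plus a positive combination of the functions `exp (-α_n |x|)`.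
  So `exp (-a |x|)` is a supersolution as long as `κ + a cot (a h) ≥ 0`
  (`expDecay_supersolution`).

With `a = α_0 / 2`, for which the cotangent vanishes, smallness of `ν` at infinity makes the
nonlinearity absorbable and gives `ν = O(exp (-α_0 |x| / 2))` (`decay_half_rate`). The right-hand
side `q` is quadratic, hence `O(exp (-α_0 |x|))`; this function occurs with a positive coefficient in
the image of `exp (-a |x|)`, so comparison gives `ν = O(exp (-a |x|))` for every `a < α_0` with
`κ + a cot (a h) ≥ 0` (`decay_sharp_rate`). The value `a = η₁ / h` is admissible because `η₁` lies in
`(π/2, π)` and `a cot (a h) = -γ / ((β - 1) √μ) ≥ -κ` there.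
-/

namespace ILW

open Filter Topology
open scoped ComplexOrder

/-! ### The Fourier transform on `L²(ℝ)` and Sobolev embedding -/

/-- Locally integrable functions that agree as tempered distributions agree almost everywhere. -/
theorem ae_eq_of_forall_integral_schwartz_smul_eq {f g : ℝ → ℂ}
    (hf : LocallyIntegrable f volume) (hg : LocallyIntegrable g volume)
    (h : ∀ φ : 𝓢(ℝ, ℂ), ∫ x, φ x • f x = ∫ x, φ x • g x) : f =ᵐ[volume] g := by
  refine ae_eq_of_integral_contDiff_smul_eq hf hg fun φ hφ hc => ?_
  have h₁ : HasCompactSupport (Complex.ofRealCLM ∘ φ) := hc.comp_left rfl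
  have h₂ : ContDiff ℝ ((⊤ : ℕ∞) : WithTop ℕ∞) (Complex.ofRealCLM ∘ φ) := by fun_prop
  simpa using h (h₁.toSchwartzMap h₂)

theorem integral_schwartz_smul_fourier (φ : 𝓢(ℝ, ℂ)) {f : ℝ → ℂ} (hf : Integrable f) :
    ∫ x, φ x • 𝓕 f x = ∫ x, (𝓕 φ) x • f x := by
  rw [SchwartzMap.fourier_coe]
  have := (VectorFourier.integral_fourierIntegral_smul_eq_flip (L := innerₗ ℝ)
    Real.continuous_fourierChar continuous_inner (φ.integrable (μ := volume)) hf).symm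
  rwa [flip_innerₗ] at this

theorem locallyIntegrable_fourier {f : ℝ → ℂ} (hf : Integrable f) :
    LocallyIntegrable (𝓕 f) (volume : Measure ℝ) :=
  (VectorFourier.fourierIntegral_continuous Real.continuous_fourierChar
    continuous_inner hf).locallyIntegrable

/-- On `L¹ ∩ L²` the Plancherel extension of the Fourier transform is the Fourier integral. -/
theorem fourier_toLp_ae_eq {f : ℝ → ℂ} (hf₁ : Integrable f) (hf₂ : MemLp f 2) :
    (𝓕 (hf₂.toLp f) : Lp ℂ 2 (volume : Measure ℝ)) =ᵐ[volume] 𝓕 f := by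
  refine ae_eq_of_forall_integral_schwartz_smul_eq
    ((Lp.memLp _).locallyIntegrable (by norm_num)) (locallyIntegrable_fourier hf₁) fun φ => ?_
  rw [integral_schwartz_smul_fourier φ hf₁, ← Lp.toTemperedDistribution_apply,
    ← Lp.fourier_toTemperedDistribution_eq, TemperedDistribution.fourier_apply,
    Lp.toTemperedDistribution_apply]
  refine integral_congr_ae ?_
  filter_upwards [hf₂.coeFn_toLp] with x hx
  rw [hx]

/-- One-dimensional Sobolev embedding: the Fourier transform of an `H¹` function is integrable, so the
Riemann-Lebesgue lemma applies to the inversion formula. -/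
theorem MemH1.tendsto_zero {f : ℝ → ℝ} (hf : MemH1 f) : Tendsto f (cocompact ℝ) (𝓝 0) := by
  obtain ⟨hc, hL, hS⟩ := hf
  obtain ⟨v, hv⟩ := hS.fourier_memL1 (by norm_num)
  have hvi : Integrable v := L1.integrable_coeFn v
  have key : (fun x => (f x : ℂ)) =ᵐ[volume] fun x => 𝓕 (v : ℝ → ℂ) (-x) := by
    refine ae_eq_of_forall_integral_schwartz_smul_eq
      (by fun_prop : Continuous fun x => (f x : ℂ)).locallyIntegrable ?_ fun φ => ?_
    · exact ((VectorFourier.fourierIntegral_continuous Real.continuous_fourierChar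
        continuous_inner hvi).comp continuous_neg).locallyIntegrable
    have h1 : ∫ x, φ x • (f x : ℂ) = Lp.toTemperedDistribution (hL.toLp _) φ := by
      rw [Lp.toTemperedDistribution_apply]
      refine integral_congr_ae ?_
      filter_upwards [hL.coeFn_toLp] with x hx
      rw [hx]
    have h2 : (∫ x, φ x • 𝓕 (v : ℝ → ℂ) (-x)) = ∫ x, (𝓕⁻ φ) x • v x := by
      rw [← integral_neg_eq_self]
      simp only [neg_neg]
      have := (VectorFourier.integral_fourierIntegral_smul_eq_flip (L := innerₗ ℝ)
        Real.continuous_fourierChar continuous_inner (φ.integrable (μ := volume)).comp_neg hvi).symm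
      rw [flip_innerₗ] at this
      refine Eq.trans this (integral_congr_ae (.of_forall fun x => ?_))
      simp only
      congr 1
      rw [SchwartzMap.fourierInv_coe, Real.fourierInv_eq_fourier_comp_neg]
      rfl
    rw [h1, h2, ← Lp.toTemperedDistribution_apply, ← hv, TemperedDistribution.fourier_apply]
    simp
  have hcv : Continuous fun x => 𝓕 (v : ℝ → ℂ) (-x) :=
    (VectorFourier.fourierIntegral_continuous Real.continuous_fourierChar
        continuous_inner hvi).comp continuous_neg
  have heq := Continuous.ae_eq_iff_eq volume (by fun_prop) hcv |>.1 key
  have hlim : Tendsto (fun x => (f x : ℂ)) (cocompact ℝ) (𝓝 0) := by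
    rw [heq]
    exact (Real.zero_at_infty_fourier v).comp (Homeomorph.neg ℝ).isClosedEmbedding.tendsto_cocompact
  exact (Complex.continuous_re.tendsto (0 : ℂ)).comp hlim

/-- Dominated convergence in `L²`. -/
theorem tendsto_L2_of_dominated {f : ℕ → Lp ℂ 2 (volume : Measure ℝ)}
    {g : Lp ℂ 2 (volume : Measure ℝ)} {b : ℝ → ℝ} (hb : MemLp b 2)
    (hfb : ∀ n, ∀ᵐ x, ‖f n x‖ ≤ b x)
    (hlim : ∀ᵐ x, Tendsto (fun n => f n x) atTop (𝓝 (g x))) : Tendsto f atTop (𝓝 g) := by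
  have hsq : Tendsto (fun n => ‖f n - g‖ ^ 2) atTop (𝓝 0) := by
    have hn : ∀ F : Lp ℂ 2 (volume : Measure ℝ), ‖F‖ ^ 2 = ∫ x, ‖F x‖ ^ 2 := by
      intro F
      have h := L2.inner_def (𝕜 := ℂ) F F
      rw [inner_self_eq_norm_sq_to_K] at h
      have h' : ((‖F‖ ^ 2 : ℝ) : ℂ) = ((∫ x, ‖F x‖ ^ 2 : ℝ) : ℂ) := by
        rw [← integral_complex_ofReal]
        simpa [inner_self_eq_norm_sq_to_K] using h
      exact_mod_cast h'
    simp only [hn]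
    rw [← integral_zero ℝ ℝ (μ := volume)]
    refine tendsto_integral_of_dominated_convergence (fun x => (2 * b x) ^ 2) ?_
      (hb.const_mul 2).integrable_sq ?_ ?_
    · intro n
      exact ((Lp.aestronglyMeasurable _).norm.pow 2)
    · intro n
      filter_upwards [Lp.coeFn_sub (f n) g, ae_all_iff.2 hfb, hlim] with x hx hx1 hx2
      rw [hx]
      have : ‖g x‖ ≤ b x := le_of_tendsto hx2.norm (.of_forall hx1)
      have h3 : ‖f n x - g x‖ ≤ 2 * b x := by linarith [norm_sub_le (f n x) (g x), hx1 n]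
      simp only [Pi.sub_apply, norm_pow, norm_norm]
      gcongr
    · have : ∀ᵐ x, ∀ n, (f n - g : Lp ℂ 2 (volume : Measure ℝ)) x = f n x - g x := by
        rw [ae_all_iff]
        intro n
        filter_upwards [Lp.coeFn_sub (f n) g] with x hx using hx
      filter_upwards [this, hlim] with x hx hx2
      simp only [hx]
      simpa using ((hx2.sub_const (g x)).norm.pow 2)
  rw [tendsto_iff_norm_sub_tendsto_zero]
  simpa using hsq.sqrt

/-! ### Positivity-preserving Fourier multipliers -/

/-- `G = m(D) F` in `L²(ℝ)`. As in `IsMultiplier`, the symbol `m` is a function of the angular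
frequency. -/
def HasSymbol (m : ℝ → ℝ) (F G : Lp ℂ 2 (volume : Measure ℝ)) : Prop :=
  ∀ᵐ y : ℝ, (𝓕 G : Lp ℂ 2 (volume : Measure ℝ)) y =
    (m (2 * Real.pi * y) : ℂ) * (𝓕 F : Lp ℂ 2 (volume : Measure ℝ)) y

/-- `F` is real-valued and nonnegative almost everywhere: `≤` is the partial order of `ℂ` in which
`0 ≤ z` means that `z` is a nonnegative real number. -/
def AENonneg (F : Lp ℂ 2 (volume : Measure ℝ)) : Prop := ∀ᵐ x, 0 ≤ F x

theorem AENonneg.add {F G : Lp ℂ 2 (volume : Measure ℝ)} (hF : AENonneg F) (hG : AENonneg G) :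
    AENonneg (F + G) := by
  filter_upwards [hF, hG, Lp.coeFn_add F G] with x h1 h2 h3
  rw [h3]
  exact add_nonneg h1 h2

theorem AENonneg.smul {F : Lp ℂ 2 (volume : Measure ℝ)} (hF : AENonneg F) {c : ℝ} (hc : 0 ≤ c) :
    AENonneg ((c : ℂ) • F) := by
  filter_upwards [hF, Lp.coeFn_smul (c : ℂ) F] with x h1 h3
  rw [h3]
  exact mul_nonneg (by exact_mod_cast hc) h1

theorem AENonneg.zero : AENonneg (0 : Lp ℂ 2 (volume : Measure ℝ)) := by
  filter_upwards [Lp.coeFn_zero ℂ 2 (volume : Measure ℝ)] with x h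
  rw [h]; rfl

theorem AENonneg.of_tendsto {F : ℕ → Lp ℂ 2 (volume : Measure ℝ)}
    {G : Lp ℂ 2 (volume : Measure ℝ)} (hF : ∀ n, AENonneg (F n)) (h : Tendsto F atTop (𝓝 G)) :
    AENonneg G := by
  obtain ⟨ns, -, hns⟩ := (tendstoInMeasure_of_tendsto_Lp h).exists_seq_tendsto_ae
  filter_upwards [ae_all_iff.2 hF, hns] with x h1 h2
  rw [Complex.nonneg_iff]
  refine ⟨ge_of_tendsto ((Complex.continuous_re.tendsto _).comp h2)
    (.of_forall fun n => (Complex.nonneg_iff.1 (h1 (ns n))).1), ?_⟩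
  refine tendsto_nhds_unique (tendsto_const_nhds (x := (0 : ℝ)) (f := atTop (α := ℕ)))
    (((Complex.continuous_im.tendsto _).comp h2).congr fun n => ?_)
  exact (Complex.nonneg_iff.1 (h1 (ns n))).2.symm

theorem HasSymbol.add {m : ℝ → ℝ} {F G F' G' : Lp ℂ 2 (volume : Measure ℝ)}
    (h : HasSymbol m F G) (h' : HasSymbol m F' G') : HasSymbol m (F + F') (G + G') := by
  unfold HasSymbol
  rw [FourierTransform.fourier_add, FourierTransform.fourier_add]
  filter_upwards [h, h', Lp.coeFn_add (𝓕 F) (𝓕 F'), Lp.coeFn_add (𝓕 G) (𝓕 G')] with y h1 h2 h3 h4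
  rw [h3, h4, Pi.add_apply, Pi.add_apply, h1, h2]; ring

theorem HasSymbol.smul {m : ℝ → ℝ} {F G : Lp ℂ 2 (volume : Measure ℝ)}
    (h : HasSymbol m F G) (c : ℂ) : HasSymbol m (c • F) (c • G) := by
  unfold HasSymbol
  rw [fourier_smul, fourier_smul]
  filter_upwards [h, Lp.coeFn_smul c (𝓕 F), Lp.coeFn_smul c (𝓕 G)] with y h1 h3 h4
  rw [h3, h4, Pi.smul_apply, Pi.smul_apply, h1, smul_eq_mul, smul_eq_mul]; ring

theorem HasSymbol.sub {m : ℝ → ℝ} {F G F' G' : Lp ℂ 2 (volume : Measure ℝ)}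
    (h : HasSymbol m F G) (h' : HasSymbol m F' G') : HasSymbol m (F - F') (G - G') := by
  have := h.add (h'.smul (-1))
  simpa [sub_eq_add_neg] using this

theorem HasSymbol.add_symbol {m m' : ℝ → ℝ} {F G G' : Lp ℂ 2 (volume : Measure ℝ)}
    (h : HasSymbol m F G) (h' : HasSymbol m' F G') :
    HasSymbol (fun y => m y + m' y) F (G + G') := by
  unfold HasSymbol
  rw [FourierTransform.fourier_add]
  filter_upwards [h, h', Lp.coeFn_add (𝓕 G) (𝓕 G')] with y h1 h2 h4
  rw [h4, Pi.add_apply, h1, h2]; push_cast; ring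

theorem HasSymbol.const_mul_symbol {m : ℝ → ℝ} {F G : Lp ℂ 2 (volume : Measure ℝ)}
    (h : HasSymbol m F G) (c : ℝ) : HasSymbol (fun y => c * m y) F ((c : ℂ) • G) := by
  unfold HasSymbol
  rw [fourier_smul]
  filter_upwards [h, Lp.coeFn_smul (c : ℂ) (𝓕 G)] with y h1 h4
  rw [h4, Pi.smul_apply, h1, smul_eq_mul]; push_cast; ring

theorem HasSymbol.trans {m m' : ℝ → ℝ} {F G H : Lp ℂ 2 (volume : Measure ℝ)}
    (h : HasSymbol m F G) (h' : HasSymbol m' G H) : HasSymbol (fun y => m' y * m y) F H := by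
  filter_upwards [h, h'] with y h1 h2
  rw [h2, h1]; push_cast; ring

theorem HasSymbol.unique {m : ℝ → ℝ} {F G G' : Lp ℂ 2 (volume : Measure ℝ)}
    (h : HasSymbol m F G) (h' : HasSymbol m F G') : G = G' := by
  have : (𝓕 G : Lp ℂ 2 (volume : Measure ℝ)) = 𝓕 G' := by
    apply Lp.ext
    filter_upwards [h, h'] with y h1 h2
    rw [h1, h2]
  exact (Lp.fourierTransformₗᵢ ℝ ℂ).injective this

theorem exists_fourier_eq {g : ℝ → ℂ} (hg : MemLp g 2) :
    ∃ G : Lp ℂ 2 (volume : Measure ℝ), (𝓕 G : Lp ℂ 2 (volume : Measure ℝ)) =ᵐ[volume] g :=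
  ⟨𝓕⁻ (hg.toLp g), by rw [fourier_fourierInv_eq]; exact hg.coeFn_toLp⟩

theorem exists_hasSymbol {m : ℝ → ℝ} (hm : Measurable m) {C : ℝ} (hC : ∀ y, |m y| ≤ C)
    (F : Lp ℂ 2 (volume : Measure ℝ)) : ∃ G, HasSymbol m F G := by
  refine exists_fourier_eq (MemLp.of_le_mul (c := C) (Lp.memLp (𝓕 F)) ?_ (.of_forall fun y => ?_))
  · exact (Complex.measurable_ofReal.comp
      (hm.comp (measurable_const_mul _))).aestronglyMeasurable.mul (Lp.aestronglyMeasurable _)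
  · rw [norm_mul, Complex.norm_real, Real.norm_eq_abs]
    gcongr
    exact hC _

theorem HasSymbol.norm_le {m : ℝ → ℝ} {C : ℝ} (hC : ∀ y, |m y| ≤ C)
    {F G : Lp ℂ 2 (volume : Measure ℝ)} (h : HasSymbol m F G) : ‖G‖ ≤ C * ‖F‖ := by
  rw [← Lp.norm_fourier_eq G, ← Lp.norm_fourier_eq F]
  refine Lp.norm_le_mul_norm_of_ae_le_mul ?_
  filter_upwards [h] with y h1
  rw [h1, norm_mul, Complex.norm_real, Real.norm_eq_abs]
  gcongr
  exact hC _

/-- If nonnegative functions have Fourier transforms that converge pointwise and dominatedly to that of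
`G`, then `G` is nonnegative: by Plancherel they converge to `G` in `L²`. -/
theorem AENonneg.of_tendsto_fourier {F : ℕ → Lp ℂ 2 (volume : Measure ℝ)}
    {G : Lp ℂ 2 (volume : Measure ℝ)} (hF : ∀ n, AENonneg (F n)) {b : ℝ → ℝ} (hb : MemLp b 2)
    (hFb : ∀ n, ∀ᵐ y, ‖(𝓕 (F n) : Lp ℂ 2 (volume : Measure ℝ)) y‖ ≤ b y)
    (hlim : ∀ᵐ y, Tendsto (fun n => (𝓕 (F n) : Lp ℂ 2 (volume : Measure ℝ)) y) atTop
      (𝓝 ((𝓕 G : Lp ℂ 2 (volume : Measure ℝ)) y))) : AENonneg G := by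
  refine AENonneg.of_tendsto hF ?_
  have := ((Lp.fourierTransformₗᵢ ℝ ℂ).symm.continuous.tendsto _).comp
    (tendsto_L2_of_dominated hb hFb hlim)
  have e : ∀ F : Lp ℂ 2 (volume : Measure ℝ), (Lp.fourierTransformₗᵢ ℝ ℂ).symm (𝓕 F) = F :=
    (Lp.fourierTransformₗᵢ ℝ ℂ).symm_apply_apply
  simpa only [Function.comp_def, e] using this

/-- `m(D)` is a bounded operator on `L²(ℝ)` that maps nonnegative functions to nonnegative functions. -/
structure IsPositiveMultiplier (m : ℝ → ℝ) : Prop where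
  measurable : Measurable m
  bounded : ∃ C, ∀ y, |m y| ≤ C
  nonneg : ∀ {F G}, HasSymbol m F G → AENonneg F → AENonneg G

namespace IsPositiveMultiplier

theorem exists_hasSymbol {m : ℝ → ℝ} (hm : IsPositiveMultiplier m)
    (F : Lp ℂ 2 (volume : Measure ℝ)) : ∃ G, HasSymbol m F G :=
  ILW.exists_hasSymbol hm.measurable hm.bounded.choose_spec F

theorem add {m m' : ℝ → ℝ} (hm : IsPositiveMultiplier m) (hm' : IsPositiveMultiplier m') :
    IsPositiveMultiplier fun y => m y + m' y := by
  obtain ⟨C, hC⟩ := hm.bounded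
  obtain ⟨C', hC'⟩ := hm'.bounded
  refine ⟨hm.measurable.add hm'.measurable, ⟨C + C', fun y => ?_⟩, fun {F G} h hF => ?_⟩
  · exact (abs_add_le _ _).trans (add_le_add (hC y) (hC' y))
  · obtain ⟨G₁, h₁⟩ := hm.exists_hasSymbol F
    obtain ⟨G₂, h₂⟩ := hm'.exists_hasSymbol F
    rw [h.unique (h₁.add_symbol h₂)]
    exact (hm.nonneg h₁ hF).add (hm'.nonneg h₂ hF)

theorem mul {m m' : ℝ → ℝ} (hm : IsPositiveMultiplier m) (hm' : IsPositiveMultiplier m') :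
    IsPositiveMultiplier fun y => m y * m' y := by
  obtain ⟨C, hC⟩ := hm.bounded
  obtain ⟨C', hC'⟩ := hm'.bounded
  refine ⟨hm.measurable.mul hm'.measurable, ⟨C * C', fun y => ?_⟩, fun {F G} h hF => ?_⟩
  · rw [abs_mul]
    exact mul_le_mul (hC y) (hC' y) (abs_nonneg _) ((abs_nonneg _).trans (hC y))
  · obtain ⟨G₂, h₂⟩ := hm'.exists_hasSymbol F
    obtain ⟨G₁, h₁⟩ := hm.exists_hasSymbol G₂
    rw [h.unique (h₂.trans h₁)]
    exact hm.nonneg h₁ (hm'.nonneg h₂ hF)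

theorem const {c : ℝ} (hc : 0 ≤ c) : IsPositiveMultiplier fun _ => c := by
  refine ⟨measurable_const, ⟨|c|, fun _ => le_rfl⟩, fun {F G} h hF => ?_⟩
  have h₁ : HasSymbol (fun _ => (1 : ℝ)) F F := .of_forall fun y => by simp
  have h₂ := h₁.const_mul_symbol c
  simp only [mul_one] at h₂
  rw [h.unique h₂]
  exact hF.smul hc

theorem sum {ι : Type*} {s : Finset ι} {m : ι → ℝ → ℝ}
    (hm : ∀ i ∈ s, IsPositiveMultiplier (m i)) :
    IsPositiveMultiplier fun y => ∑ i ∈ s, m i y := by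
  classical
  induction s using Finset.induction_on with
  | empty => simpa using const le_rfl
  | insert i s hi ih =>
    simp only [Finset.sum_insert hi]
    exact (hm i (by simp)).add (ih fun j hj => hm j (by simp [hj]))

theorem pow {m : ℝ → ℝ} (hm : IsPositiveMultiplier m) (k : ℕ) :
    IsPositiveMultiplier fun y => m y ^ k := by
  induction k with
  | zero => simpa using const zero_le_one
  | succ k ih => simpa only [pow_succ] using ih.mul hm

theorem of_tendsto {m : ℕ → ℝ → ℝ} {M : ℝ → ℝ} (hm : ∀ n, IsPositiveMultiplier (m n)) {C : ℝ}
    (hC : ∀ n y, |m n y| ≤ C) (hlim : ∀ y, Tendsto (fun n => m n y) atTop (𝓝 (M y))) :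
    IsPositiveMultiplier M := by
  refine ⟨measurable_of_tendsto_metrizable (fun n => (hm n).measurable) (tendsto_pi_nhds.2 hlim),
    ⟨C, fun y => le_of_tendsto (hlim y).abs (.of_forall fun n => hC n y)⟩, fun {F G} h hF => ?_⟩
  choose G' hG' using fun n => (hm n).exists_hasSymbol F
  refine AENonneg.of_tendsto_fourier (fun n => (hm n).nonneg (hG' n) hF)
    ((Lp.memLp (𝓕 F)).norm.const_mul C) (fun n => ?_) ?_
  · filter_upwards [hG' n] with y hy
    rw [hy, norm_mul, Complex.norm_real, Real.norm_eq_abs]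
    gcongr
    exact hC _ _
  · filter_upwards [ae_all_iff.2 hG', h] with y h1 h2
    simp only [h1, h2]
    exact ((Complex.continuous_ofReal.tendsto _).comp (hlim _)).mul_const _

/-- Neumann series: `1 / (C - j) = ∑ j ^ k / C ^ (k + 1)`. -/
theorem one_div_const_sub {j : ℝ → ℝ} (hj : IsPositiveMultiplier j) {C C' : ℝ}
    (h0 : ∀ y, 0 ≤ j y) (hC' : ∀ y, j y ≤ C') (hC : C' < C) :
    IsPositiveMultiplier fun y => 1 / (C - j y) := by
  have hCpos : 0 < C := ((h0 0).trans (hC' 0)).trans_lt hC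
  have hr0 : ∀ y, 0 ≤ j y / C := fun y => div_nonneg (h0 y) hCpos.le
  have hr1 : ∀ y, j y / C ≤ C' / C := fun y => by gcongr; exact hC' y
  have hr : C' / C < 1 := (div_lt_one hCpos).2 hC
  have hs : ∀ y, HasSum (fun k => (j y / C) ^ k) (1 - j y / C)⁻¹ := fun y =>
    hasSum_geometric_of_lt_one (hr0 y) ((hr1 y).trans_lt hr)
  refine of_tendsto (m := fun n y => 1 / C * ∑ k ∈ Finset.range n, (1 / C * j y) ^ k)
    (C := 1 / C * (1 - C' / C)⁻¹) (fun n => ?_) (fun n y => ?_) fun y => ?_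
  · exact (const (by positivity)).mul (sum fun k _ => ((const (by positivity)).mul hj).pow k)
  · simp only [← div_eq_inv_mul, one_div]
    rw [abs_of_nonneg]
    · gcongr
      refine ((hs y).summable.sum_le_tsum _ fun k _ => pow_nonneg (hr0 y) k).trans ?_
      rw [(hs y).tsum_eq]
      have : 0 < 1 - C' / C := by linarith
      gcongr
      exact hC' y
    · exact div_nonneg (Finset.sum_nonneg fun k _ => pow_nonneg (hr0 y) k) hCpos.le
  · have h := ((hs y).tendsto_sum_nat).const_mul (1 / C)
    have e : 1 / C * (1 - j y / C)⁻¹ = 1 / (C - j y) := by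
      have : C - j y ≠ 0 := by linarith [hC' y]
      field_simp
    rw [e] at h
    simpa only [one_div_mul_eq_div] using h

end IsPositiveMultiplier

/-! ### Two-sided exponentials -/

theorem integrable_exp_neg_mul_abs {a : ℝ} (ha : 0 < a) :
    Integrable fun x : ℝ => Real.exp (-a * |x|) := by
  rw [← integrableOn_univ, ← Set.Iic_union_Ioi (a := (0 : ℝ)), integrableOn_union]
  constructor
  · refine (integrableOn_exp_mul_Iic ha 0).congr_fun (fun x hx => ?_) measurableSet_Iic
    simp only [abs_of_nonpos (Set.mem_Iic.1 hx), neg_mul_neg]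
  · refine (integrableOn_exp_mul_Ioi (neg_lt_zero.2 ha) 0).congr_fun (fun x hx => ?_)
      measurableSet_Ioi
    simp only [abs_of_pos (Set.mem_Ioi.1 hx)]

theorem memLp_exp_neg_mul_abs {a : ℝ} (ha : 0 < a) :
    MemLp (fun x : ℝ => (Real.exp (-a * |x|) : ℂ)) 2 := by
  have h : MemLp (fun x : ℝ => Real.exp (-a * |x|)) 2 := by
    refine (memLp_two_iff_integrable_sq (by fun_prop)).2 ?_
    refine (integrable_exp_neg_mul_abs (a := 2 * a) (by positivity)).congr (.of_forall fun x => ?_)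
    simp only
    rw [← Real.exp_nat_mul]
    congr 1
    push_cast; ring
  exact h.ofReal

theorem fourier_exp_neg_mul_abs {a : ℝ} (ha : 0 < a) (y : ℝ) :
    𝓕 (fun x : ℝ => (Real.exp (-a * |x|) : ℂ)) y =
      ((2 * a / ((2 * Real.pi * y) ^ 2 + a ^ 2) : ℝ) : ℂ) := by
  rw [Real.fourier_real_eq_integral_exp_smul]
  have hi : Integrable fun x : ℝ =>
      Complex.exp (((-2 * Real.pi * x * y : ℝ) : ℂ) * Complex.I) • (Real.exp (-a * |x|) : ℂ) := by
    refine (integrable_exp_neg_mul_abs ha).mono (by fun_prop) (.of_forall fun x => ?_)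
    rw [norm_smul, Complex.norm_exp_ofReal_mul_I, one_mul, Complex.norm_real]
  rw [← intervalIntegral.integral_Iic_add_Ioi (b := 0) hi.integrableOn hi.integrableOn]
  set w : ℂ := ((2 * Real.pi * y : ℝ) : ℂ) with hw
  have h1 : ∀ x ∈ Set.Iic (0 : ℝ),
      Complex.exp (((-2 * Real.pi * x * y : ℝ) : ℂ) * Complex.I) • (Real.exp (-a * |x|) : ℂ) =
        Complex.exp ((a - w * Complex.I) * x) := by
    intro x hx
    rw [abs_of_nonpos hx, smul_eq_mul, Complex.ofReal_exp, ← Complex.exp_add, hw]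
    congr 1; push_cast; ring
  have h2 : ∀ x ∈ Set.Ioi (0 : ℝ),
      Complex.exp (((-2 * Real.pi * x * y : ℝ) : ℂ) * Complex.I) • (Real.exp (-a * |x|) : ℂ) =
        Complex.exp ((-a - w * Complex.I) * x) := by
    intro x hx
    rw [abs_of_pos hx, smul_eq_mul, Complex.ofReal_exp, ← Complex.exp_add, hw]
    congr 1; push_cast; ring
  rw [setIntegral_congr_fun measurableSet_Iic h1, setIntegral_congr_fun measurableSet_Ioi h2,
    integral_exp_mul_complex_Iic (by simp [hw, ha]), integral_exp_mul_complex_Ioi (by simp [hw, ha])]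
  have e : (a : ℂ) - w * Complex.I ≠ 0 := fun h => ha.ne' (by simpa [hw] using congrArg Complex.re h)
  have e' : (a : ℂ) + w * Complex.I ≠ 0 := fun h => ha.ne' (by simpa [hw] using congrArg Complex.re h)
  have e'' : -(a : ℂ) - w * Complex.I ≠ 0 := fun h => e' (by linear_combination -h)
  have e3 : w ^ 2 + (a : ℂ) ^ 2 ≠ 0 := by
    have : (a - w * Complex.I) * (a + w * Complex.I) = w ^ 2 + (a : ℂ) ^ 2 := by
      linear_combination -w ^ 2 * Complex.I_sq
    rw [← this]; exact mul_ne_zero e e'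
  have e4 : ((2 * a / ((2 * Real.pi * y) ^ 2 + a ^ 2) : ℝ) : ℂ) = 2 * a / (w ^ 2 + a ^ 2) := by
    rw [hw]; push_cast; rfl
  rw [e4]
  simp only [Complex.ofReal_zero, mul_zero, Complex.exp_zero]
  have e5 : -1 / (-(a : ℂ) - w * Complex.I) = 1 / (a + w * Complex.I) := by
    rw [div_eq_div_iff e'' e']; ring
  rw [e5, div_add_div _ _ e e', div_eq_div_iff (mul_ne_zero e e') e3]
  linear_combination 2 * a * w ^ 2 * Complex.I_sq

/-- The function `x ↦ exp (-a |x|)` as an element of `L²(ℝ)`. -/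
noncomputable def expDecay (a : ℝ) (ha : 0 < a) : Lp ℂ 2 (volume : Measure ℝ) :=
  (memLp_exp_neg_mul_abs ha).toLp _

theorem coeFn_expDecay {a : ℝ} (ha : 0 < a) :
    expDecay a ha =ᵐ[volume] fun x => (Real.exp (-a * |x|) : ℂ) :=
  (memLp_exp_neg_mul_abs ha).coeFn_toLp

theorem expDecay_nonneg {a : ℝ} (ha : 0 < a) : AENonneg (expDecay a ha) := by
  filter_upwards [coeFn_expDecay ha] with x hx
  rw [hx]
  exact_mod_cast (Real.exp_pos _).le

theorem fourier_expDecay {a : ℝ} (ha : 0 < a) :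
    (𝓕 (expDecay a ha) : Lp ℂ 2 (volume : Measure ℝ)) =ᵐ[volume]
      fun y => ((2 * a / ((2 * Real.pi * y) ^ 2 + a ^ 2) : ℝ) : ℂ) := by
  filter_upwards [fourier_toLp_ae_eq (integrable_exp_neg_mul_abs ha).ofReal
    (memLp_exp_neg_mul_abs ha)] with y hy
  rw [← fourier_exp_neg_mul_abs ha y]
  exact hy

open Convolution in
/-- `1 / (D² + a²)` is convolution with the positive function `exp (-a |x|) / (2 a)`. -/
theorem IsPositiveMultiplier.one_div_sq_add_sq {a : ℝ} (ha : 0 < a) :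
    IsPositiveMultiplier fun y => 1 / (y ^ 2 + a ^ 2) := by
  suffices H : IsPositiveMultiplier fun y => 2 * a / (y ^ 2 + a ^ 2) by
    have := (IsPositiveMultiplier.const (c := 1 / (2 * a)) (by positivity)).mul H
    convert this using 2 with y
    field_simp
  have hbd : ∀ y : ℝ, |2 * a / (y ^ 2 + a ^ 2)| ≤ 2 * a / a ^ 2 := fun y => by
    rw [abs_of_nonneg (by positivity)]
    gcongr
    nlinarith
  have hmeas : Measurable fun y : ℝ => 2 * a / (y ^ 2 + a ^ 2) := by fun_prop
  refine ⟨hmeas, ⟨_, hbd⟩, fun {F G} h hF => ?_⟩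
  -- The convolution theorem is available for integrable functions only, so `F` is approximated by
  -- its truncations to bounded intervals.
  have hmem : ∀ n : ℕ, MemLp ((Set.Icc (-n : ℝ) n).indicator F) 2 := fun n =>
    (Lp.memLp F).indicator measurableSet_Icc
  set Fn : ℕ → Lp ℂ 2 (volume : Measure ℝ) := fun n => (hmem n).toLp _ with hFn
  have hFnlim : Tendsto Fn atTop (𝓝 F) := by
    refine tendsto_L2_of_dominated (Lp.memLp F).norm (fun n => ?_) ?_
    · filter_upwards [(hmem n).coeFn_toLp] with x hx
      rw [hx]
      exact norm_indicator_le_norm_self _ _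
    · filter_upwards [ae_all_iff.2 fun n => (hmem n).coeFn_toLp] with x hx
      refine tendsto_const_nhds.congr' ?_
      obtain ⟨N, hN⟩ := exists_nat_ge |x|
      filter_upwards [eventually_ge_atTop N] with n hn
      rw [hx n, Set.indicator_of_mem]
      have : (N : ℝ) ≤ n := by exact_mod_cast hn
      exact abs_le.1 (hN.trans this)
  choose Gn hGn using fun n => ILW.exists_hasSymbol hmeas hbd (Fn n)
  have hGlim : Tendsto Gn atTop (𝓝 G) := by
    rw [tendsto_iff_norm_sub_tendsto_zero] at hFnlim ⊢
    refine squeeze_zero (fun _ => norm_nonneg _)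
      (fun n => ((hGn n).sub h).norm_le hbd) ?_
    simpa using hFnlim.const_mul (2 * a / a ^ 2)
  refine AENonneg.of_tendsto (fun n => ?_) hGlim
  set f : ℝ → ℂ := (Set.Icc (-n : ℝ) n).indicator F with hf
  set k : ℝ → ℂ := fun x => (Real.exp (-a * |x|) : ℂ) with hk
  have hki : Integrable k := (integrable_exp_neg_mul_abs ha).ofReal
  have hfi : Integrable f := by
    rw [hf, integrable_indicator_iff measurableSet_Icc]
    exact ((Lp.memLp F).restrict _).integrable (by norm_num)
  have hf0 : ∀ᵐ x, 0 ≤ f x := by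
    filter_upwards [hF] with x hx
    exact Set.indicator_apply_nonneg fun _ => hx
  have hci : Integrable (f ⋆[ContinuousLinearMap.mul ℂ ℂ, volume] k) :=
    hfi.integrable_convolution _ hki
  have hc0 : ∀ x, 0 ≤ (f ⋆[ContinuousLinearMap.mul ℂ ℂ, volume] k) x := fun x => by
    refine integral_nonneg_of_ae ?_
    filter_upwards [hf0] with t ht
    exact mul_nonneg ht (Complex.zero_le_real.2 (Real.exp_pos _).le)
  have hcb : ∀ x, ‖(f ⋆[ContinuousLinearMap.mul ℂ ℂ, volume] k) x‖ ≤ ∫ t, ‖f t‖ := fun x => by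
    refine norm_integral_le_of_norm_le hfi.norm (.of_forall fun t => ?_)
    simp only [ContinuousLinearMap.mul_apply', norm_mul]
    refine mul_le_of_le_one_right (norm_nonneg _) ?_
    rw [hk, Complex.norm_real, Real.norm_of_nonneg (Real.exp_pos _).le, Real.exp_le_one_iff]
    nlinarith [abs_nonneg (x - t)]
  have hc2 : MemLp (f ⋆[ContinuousLinearMap.mul ℂ ℂ, volume] k) 2 := by
    refine (memLp_two_iff_integrable_sq_norm hci.aestronglyMeasurable).2 ?_
    refine (hci.norm.const_mul (∫ t, ‖f t‖)).mono' (hci.aestronglyMeasurable.norm.pow 2)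
      (.of_forall fun x => ?_)
    rw [norm_pow, norm_norm, sq]
    exact mul_le_mul_of_nonneg_right (hcb x) (norm_nonneg _)
  have hs : HasSymbol (fun y => 2 * a / (y ^ 2 + a ^ 2)) (Fn n) (hc2.toLp _) := by
    filter_upwards [fourier_toLp_ae_eq hci hc2, fourier_toLp_ae_eq hfi (hmem n)] with y h1 h2
    rw [h1, h2, Real.fourier_mul_convolution_eq hfi hki, fourier_exp_neg_mul_abs ha, mul_comm]
  rw [(hGn n).unique hs]
  filter_upwards [hc2.coeFn_toLp] with x hx
  rw [hx]
  exact hc0 x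

/-! ### The symbol `|y| coth (h |y|)`: positivity of the inverse and supersolutions -/

/-- The numbers `α_n = (n + 1) π / h`: the poles of `z ↦ z coth (h z)` are `± i α_n`. -/
noncomputable def stripFreq (h : ℝ) (n : ℕ) : ℝ := (n + 1) * Real.pi / h

theorem stripFreq_pos {h : ℝ} (hh : 0 < h) (n : ℕ) : 0 < stripFreq h n := by
  unfold stripFreq; positivity

theorem stripFreq_zero (h : ℝ) : stripFreq h 0 = Real.pi / h := by simp [stripFreq]

theorem stripFreq_zero_le {h : ℝ} (hh : 0 < h) (n : ℕ) : stripFreq h 0 ≤ stripFreq h n := by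
  unfold stripFreq
  gcongr
  simp

/-- The Mittag-Leffler expansion `z cot (z h) = 1/h + (2/h) ∑ z² / (z² - α_n²)`. -/
theorem tendsto_mul_cot {h : ℝ} (hh : 0 < h) {z : ℂ}
    (hz : z * h / Real.pi ∈ Complex.integerComplement) :
    Tendsto (fun N : ℕ => 1 / (h : ℂ) + 2 / h * ∑ n ∈ Finset.range N,
      z ^ 2 / (z ^ 2 - (stripFreq h n : ℂ) ^ 2)) atTop (𝓝 (z * Complex.cot (z * h))) := by
  have hπ : (Real.pi : ℂ) ≠ 0 := by exact_mod_cast Real.pi_ne_zero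
  have hh' : (h : ℂ) ≠ 0 := by exact_mod_cast hh.ne'
  have hz0 : z ≠ 0 := by
    rintro rfl
    exact Complex.integerComplement.ne_zero hz (by simp)
  have key := ((tendsto_logDeriv_euler_cot_sub hz).const_mul (z / Real.pi)).const_add (1 / (h : ℂ))
  have e : 1 / (h : ℂ) + z / Real.pi * (Real.pi * Complex.cot (Real.pi * (z * h / Real.pi)) -
      1 / (z * h / Real.pi)) = z * Complex.cot (z * h) := by
    rw [mul_div_cancel₀ _ hπ]
    field_simp
    ring
  rw [e] at key
  refine key.congr fun N => ?_
  rw [Finset.mul_sum, Finset.mul_sum]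
  congr 1
  refine Finset.sum_congr rfl fun n _ => ?_
  rw [cotTerm_identity hz]
  have hn := Complex.integerComplement_add_ne_zero hz ((n : ℤ) + 1)
  have hn' := Complex.integerComplement_add_ne_zero hz (-((n : ℤ) + 1))
  push_cast at hn hn'
  have h1 : z ^ 2 - (stripFreq h n : ℂ) ^ 2 =
      (z * h / Real.pi + (n + 1)) * (z * h / Real.pi - (n + 1)) * (Real.pi / h) ^ 2 := by
    unfold stripFreq
    push_cast
    field_simp
    ring
  have hn'' : z * h / Real.pi - ((n : ℂ) + 1) ≠ 0 := by rwa [sub_eq_add_neg]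
  rw [h1]
  generalize hA : z * h / Real.pi + ((n : ℂ) + 1) = A at hn
  generalize hB : z * h / Real.pi - ((n : ℂ) + 1) = B at hn''
  field_simp

theorem tendsto_mul_cot_real {h a : ℝ} (hh : 0 < h) (ha : 0 < a) (hah : a * h < Real.pi) :
    Tendsto (fun N : ℕ => 1 / h - 2 / h * ∑ n ∈ Finset.range N,
      a ^ 2 / (stripFreq h n ^ 2 - a ^ 2)) atTop (𝓝 (a * Real.cot (a * h))) := by
  have hz : (a : ℂ) * h / Real.pi ∈ Complex.integerComplement := by
    rintro ⟨k, hk⟩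
    have hk' : (k : ℝ) = a * h / Real.pi := by exact_mod_cast hk
    have h0 : (0 : ℝ) < k := by rw [hk']; positivity
    have h1 : (k : ℝ) < 1 := by rw [hk', div_lt_one Real.pi_pos]; exact hah
    have h0' : 0 < k := by exact_mod_cast h0
    have h1' : k < 1 := by exact_mod_cast h1
    omega
  have := (Complex.continuous_re.tendsto _).comp (tendsto_mul_cot hh hz)
  have e : (a * Complex.cot (a * h) : ℂ).re = a * Real.cot (a * h) := by
    rw [← Complex.ofReal_mul, ← Complex.ofReal_cot, ← Complex.ofReal_mul, Complex.ofReal_re]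
  rw [e] at this
  refine this.congr fun N => ?_
  have : (1 / (h : ℂ) + 2 / h * ∑ n ∈ Finset.range N,
      (a : ℂ) ^ 2 / ((a : ℂ) ^ 2 - (stripFreq h n : ℂ) ^ 2)) =
      ((1 / h + 2 / h * ∑ n ∈ Finset.range N, a ^ 2 / (a ^ 2 - stripFreq h n ^ 2) : ℝ) : ℂ) := by
    push_cast; rfl
  simp only [Function.comp_apply]
  rw [this, Complex.ofReal_re, sub_eq_add_neg, ← mul_neg, ← Finset.sum_neg_distrib]
  congr 2
  refine Finset.sum_congr rfl fun n _ => ?_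
  rw [← div_neg, neg_sub]

/-- The partial sums of the expansion `|y| coth (h |y|) = 1/h + (2/h) ∑ y² / (y² + α_n²)`. -/
noncomputable def dispPartial (h : ℝ) (N : ℕ) (y : ℝ) : ℝ :=
  1 / h + 2 / h * ∑ n ∈ Finset.range N, y ^ 2 / (y ^ 2 + stripFreq h n ^ 2)

theorem tendsto_dispPartial {μ₂ : ℝ} (hμ₂ : 0 < μ₂) (y : ℝ) :
    Tendsto (fun N => dispPartial √μ₂ N y) atTop (𝓝 (dispSymbol μ₂ y)) := by
  set h := √μ₂ with hdef
  have hh : 0 < h := Real.sqrt_pos.2 hμ₂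
  unfold dispPartial dispSymbol
  split_ifs with hy
  · simp [hy, ← hdef]
  have hy' : 0 < |y| := abs_pos.2 hy
  set t := |y| with ht
  have hyt : y ^ 2 = t ^ 2 := (sq_abs y).symm
  have hz : (t * Complex.I : ℂ) * h / Real.pi ∈ Complex.integerComplement := by
    rintro ⟨k, hk⟩
    have e : (t * Complex.I : ℂ) * h / Real.pi = ((t * h / Real.pi : ℝ) : ℂ) * Complex.I := by
      push_cast; ring
    rw [e] at hk
    have h1 := congrArg Complex.im hk
    rw [Complex.im_ofReal_mul, Complex.I_im, mul_one, Complex.intCast_im] at h1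
    have h2 : 0 < t * h / Real.pi := by positivity
    exact h2.ne h1
  have := (Complex.continuous_re.tendsto _).comp (tendsto_mul_cot hh hz)
  have e : (t * Complex.I * Complex.cot (t * Complex.I * h) : ℂ).re =
      t * (Real.cosh (h * t) / Real.sinh (h * t)) := by
    have e1 : (t * Complex.I * h : ℂ) = ((h * t : ℝ) : ℂ) * Complex.I := by push_cast; ring
    have e2 : (t * Complex.I * Complex.cot (t * Complex.I * h) : ℂ) =
        ((t * (Real.cosh (h * t) / Real.sinh (h * t)) : ℝ) : ℂ) := by
      rw [e1, Complex.cot, Complex.cos_mul_I, Complex.sin_mul_I, ← Complex.ofReal_cosh,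
        ← Complex.ofReal_sinh]
      have : (Real.sinh (h * t) : ℂ) ≠ 0 := by
        exact_mod_cast (Real.sinh_pos_iff.2 (by positivity)).ne'
      push_cast at this ⊢
      field_simp [Complex.I_ne_zero]
    rw [e2, Complex.ofReal_re]
  rw [e] at this
  refine this.congr fun N => ?_
  have : (1 / (h : ℂ) + 2 / h * ∑ n ∈ Finset.range N,
      (t * Complex.I : ℂ) ^ 2 / ((t * Complex.I : ℂ) ^ 2 - (stripFreq h n : ℂ) ^ 2)) =
      ((1 / h + 2 / h * ∑ n ∈ Finset.range N, t ^ 2 / (t ^ 2 + stripFreq h n ^ 2) : ℝ) : ℂ) := by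
    push_cast
    congr 2
    refine Finset.sum_congr rfl fun n _ => ?_
    rw [mul_pow, Complex.I_sq, mul_neg_one, ← neg_div_neg_eq, neg_neg, neg_sub, sub_neg_eq_add,
      add_comm]
  simp only [Function.comp_apply]
  rw [this, Complex.ofReal_re, hyt]

theorem dispPartial_pos {h : ℝ} (hh : 0 < h) (N : ℕ) (y : ℝ) : 0 < dispPartial h N y :=
  add_pos_of_pos_of_nonneg (by positivity)
    (mul_nonneg (by positivity) (Finset.sum_nonneg fun n _ => by positivity))

theorem dispSymbol_nonneg {μ₂ : ℝ} (hμ₂ : 0 < μ₂) (y : ℝ) : 0 ≤ dispSymbol μ₂ y :=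
  ge_of_tendsto (tendsto_dispPartial hμ₂ y)
    (.of_forall fun N => (dispPartial_pos (Real.sqrt_pos.2 hμ₂) N y).le)

/-- Since `y² / (y² + α²) = 1 - α² / (y² + α²)`, the symbol is `1 / (C - j)` with `j` a positive
multiplier, and a Neumann series applies. -/
theorem isPositiveMultiplier_one_div_add_dispPartial {κ h : ℝ} (hκ : 0 < κ) (hh : 0 < h) (N : ℕ) :
    IsPositiveMultiplier fun y => 1 / (κ + dispPartial h N y) := by
  set j : ℝ → ℝ := fun y =>
    ∑ n ∈ Finset.range N, 2 / h * stripFreq h n ^ 2 * (1 / (y ^ 2 + stripFreq h n ^ 2)) with hj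
  have hjpos : IsPositiveMultiplier j := IsPositiveMultiplier.sum fun n _ =>
    (IsPositiveMultiplier.const (by positivity)).mul
      (IsPositiveMultiplier.one_div_sq_add_sq (stripFreq_pos hh n))
  have h0 : ∀ y, 0 ≤ j y := fun y => Finset.sum_nonneg fun n _ => by positivity
  have e : ∀ y, dispPartial h N y = 1 / h + 2 / h * N - j y := fun y => by
    have : (N : ℝ) = ∑ n ∈ Finset.range N, (1 : ℝ) := by simp
    rw [dispPartial, hj, add_sub_assoc, this, Finset.mul_sum, Finset.mul_sum,
      ← Finset.sum_sub_distrib]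
    congr 1
    refine Finset.sum_congr rfl fun n _ => ?_
    have : y ^ 2 + stripFreq h n ^ 2 ≠ 0 := by
      have := stripFreq_pos hh n; positivity
    field_simp
    ring
  have := hjpos.one_div_const_sub (C := κ + (1 / h + 2 / h * N)) (C' := 1 / h + 2 / h * N) h0
    (fun y => by linarith [e y, dispPartial_pos hh N y]) (by linarith)
  refine (funext fun y => ?_ : (fun y => 1 / (κ + dispPartial h N y)) = _) ▸ this
  rw [e, ← add_sub_assoc]

/-- The operator `(κ + |D| coth (√μ₂ |D|))⁻¹` preserves positivity. -/
theorem isPositiveMultiplier_one_div_add_dispSymbol {κ μ₂ : ℝ} (hκ : 0 < κ) (hμ₂ : 0 < μ₂) :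
    IsPositiveMultiplier fun y => 1 / (κ + dispSymbol μ₂ y) := by
  have hh : 0 < √μ₂ := Real.sqrt_pos.2 hμ₂
  refine IsPositiveMultiplier.of_tendsto (C := 1 / κ)
    (fun N => isPositiveMultiplier_one_div_add_dispPartial hκ hh N) (fun N y => ?_) fun y => ?_
  · have := dispPartial_pos hh N y
    rw [abs_of_nonneg (by positivity)]
    gcongr
    linarith
  · have := dispSymbol_nonneg hμ₂ y
    exact tendsto_const_nhds.div ((tendsto_dispPartial hμ₂ y).const_add κ) (by positivity)

/-- The coefficient of `exp (-α_n |x|)` in `(κ + |D| coth (h |D|)) exp (-a |x|)`, for `0 < a < α_0`. -/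
noncomputable def superCoeff (h a : ℝ) (n : ℕ) : ℝ :=
  2 / h * (a * stripFreq h n / (stripFreq h n ^ 2 - a ^ 2))

theorem superCoeff_pos {h a : ℝ} (hh : 0 < h) (ha : 0 < a) (hah : a * h < Real.pi) (n : ℕ) :
    0 < superCoeff h a n := by
  have h1 : a < stripFreq h n := by
    refine lt_of_lt_of_le ?_ (stripFreq_zero_le hh n)
    rw [stripFreq_zero, lt_div_iff₀ hh]; exact hah
  have h2 : 0 < stripFreq h n ^ 2 - a ^ 2 := by nlinarith
  have := stripFreq_pos hh n
  unfold superCoeff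
  positivity

/-- Subtracting the expansions at `i y` and at `a` gives the Fourier transform of
`(|D| coth (h |D|) - a cot (a h)) exp (-a |x|)` as a sum of transforms of `exp (-α_n |x|)` with
positive coefficients. -/
theorem tendsto_sum_superCoeff {μ₂ a : ℝ} (hμ₂ : 0 < μ₂) (ha : 0 < a) (hah : a * √μ₂ < Real.pi)
    (y : ℝ) : Tendsto (fun N => ∑ n ∈ Finset.range N, superCoeff √μ₂ a n *
      (2 * stripFreq √μ₂ n / (y ^ 2 + stripFreq √μ₂ n ^ 2))) atTop
      (𝓝 (2 * a * (dispSymbol μ₂ y - a * Real.cot (a * √μ₂)) / (y ^ 2 + a ^ 2))) := by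
  have hh : 0 < √μ₂ := Real.sqrt_pos.2 hμ₂
  have key := ((((tendsto_dispPartial hμ₂ y).sub (tendsto_mul_cot_real hh ha hah)).const_mul
    (2 * a)).div_const (y ^ 2 + a ^ 2))
  refine key.congr fun N => ?_
  unfold dispPartial
  generalize √μ₂ = h at *
  rw [add_sub_sub_cancel, ← mul_add, ← Finset.sum_add_distrib, div_eq_iff (by positivity),
    Finset.sum_mul, Finset.mul_sum, Finset.mul_sum]
  refine Finset.sum_congr rfl fun n _ => ?_
  have h1 : a < stripFreq h n := by
    refine lt_of_lt_of_le ?_ (stripFreq_zero_le hh n)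
    rw [stripFreq_zero, lt_div_iff₀ hh]; exact hah
  have h2 : stripFreq h n ^ 2 - a ^ 2 ≠ 0 := by
    have : 0 < stripFreq h n ^ 2 - a ^ 2 := by nlinarith
    exact this.ne'
  have h3 : y ^ 2 + stripFreq h n ^ 2 ≠ 0 := by
    have := stripFreq_pos hh n; positivity
  unfold superCoeff
  field_simp
  ring

/-- A nonnegative combination of exponentials `exp (-α_n |x|)`, with its Fourier transform. -/
theorem exists_sum_expDecay {s : Finset ℕ} {α d : ℕ → ℝ} (hα : ∀ n, 0 < α n) (hd : ∀ n, 0 ≤ d n) :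
    ∃ H : Lp ℂ 2 (volume : Measure ℝ), AENonneg H ∧
      (𝓕 H : Lp ℂ 2 (volume : Measure ℝ)) =ᵐ[volume]
        fun y => ((∑ n ∈ s, d n * (2 * α n / ((2 * Real.pi * y) ^ 2 + α n ^ 2)) : ℝ) : ℂ) := by
  classical
  induction s using Finset.induction_on with
  | empty =>
    refine ⟨0, AENonneg.zero, ?_⟩
    have : (𝓕 (0 : Lp ℂ 2 (volume : Measure ℝ)) : Lp ℂ 2 (volume : Measure ℝ)) = 0 :=
      (Lp.fourierTransformₗᵢ ℝ ℂ).map_zero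
    rw [this]
    filter_upwards [Lp.coeFn_zero ℂ 2 (volume : Measure ℝ)] with y hy
    rw [hy]
    simp
  | insert i s hi ih =>
    obtain ⟨H, hH, hH'⟩ := ih
    refine ⟨(d i : ℂ) • expDecay (α i) (hα i) + H, ((expDecay_nonneg _).smul (hd i)).add hH, ?_⟩
    rw [FourierTransform.fourier_add, FourierTransform.fourier_smul]
    filter_upwards [hH', Lp.coeFn_add ((d i : ℂ) • 𝓕 (expDecay (α i) (hα i))) (𝓕 H),
      Lp.coeFn_smul (d i : ℂ) (𝓕 (expDecay (α i) (hα i))), fourier_expDecay (hα i)] with y h1 h2 h3 h4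
    rw [h2, Pi.add_apply, h3, Pi.smul_apply, h4, h1, Finset.sum_insert hi, smul_eq_mul,
      Complex.ofReal_add, Complex.ofReal_mul]

/-- If `κ + a cot (a h) ≥ 0` with `h = √μ₂`, then `exp (-a |x|)` dominates the images under
`(κ + |D| coth (h |D|))⁻¹` of the first two terms of `(κ + |D| coth (h |D|)) exp (-a |x|)`, because
all further terms are positive. Keeping these two terms yields both uses: the first one bounds the
image of `exp (-a |x|)` itself, the second one that of `exp (-α_0 |x|)`. -/
theorem expDecay_supersolution {κ μ₂ a : ℝ} (hκ : 0 < κ) (hμ₂ : 0 < μ₂) (ha : 0 < a)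
    (hah : a * √μ₂ < Real.pi) (hF : 0 ≤ κ + a * Real.cot (a * √μ₂))
    {hα : 0 < stripFreq √μ₂ 0} {G G₁ : Lp ℂ 2 (volume : Measure ℝ)}
    (hG : HasSymbol (fun y => 1 / (κ + dispSymbol μ₂ y)) (expDecay a ha) G)
    (hG₁ : HasSymbol (fun y => 1 / (κ + dispSymbol μ₂ y)) (expDecay (stripFreq √μ₂ 0) hα) G₁) :
    AENonneg (expDecay a ha - ((κ + a * Real.cot (a * √μ₂) : ℝ) : ℂ) • G -
      (superCoeff √μ₂ a 0 : ℂ) • G₁) := by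
  set f := κ + a * Real.cot (a * √μ₂) with hf
  have hh : 0 < √μ₂ := Real.sqrt_pos.2 hμ₂
  have hm := isPositiveMultiplier_one_div_add_dispSymbol hκ hμ₂
  have hd := superCoeff_pos hh ha hah
  -- `H N` is a partial sum of `(κ + |D| coth (√μ₂ |D|)) exp (-a |x|)` without the terms in
  -- `exp (-a |x|)` and `exp (-α_0 |x|)`, and `K N` is its image under the inverse operator. Their
  -- Fourier transforms are dominated by that of `exp (-a |x|)`.
  choose H hH0 hH using fun N => exists_sum_expDecay (s := Finset.range N)
    (α := fun n => stripFreq √μ₂ (n + 1)) (d := fun n => superCoeff √μ₂ a (n + 1))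
    (fun n => stripFreq_pos hh _) (fun n => (hd _).le)
  choose K hK using fun N => hm.exists_hasSymbol (H N)
  refine AENonneg.of_tendsto_fourier (fun N => hm.nonneg (hK N) (hH0 N))
    (Lp.memLp (𝓕 (expDecay a ha))).norm (fun N => ?_) ?_
  · filter_upwards [hH N, hK N, fourier_expDecay ha] with y h1 h2 h3
    rw [h2, h1, h3, ← Complex.ofReal_mul, Complex.norm_real, Complex.norm_real]
    generalize 2 * Real.pi * y = ω
    have hs := dispSymbol_nonneg hμ₂ ω
    have hterm : ∀ n, 0 ≤ superCoeff √μ₂ a n *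
        (2 * stripFreq √μ₂ n / (ω ^ 2 + stripFreq √μ₂ n ^ 2)) := fun n => by
      have := hd n
      have := stripFreq_pos hh n
      positivity
    have hle : ∑ n ∈ Finset.range N, superCoeff √μ₂ a (n + 1) *
        (2 * stripFreq √μ₂ (n + 1) / (ω ^ 2 + stripFreq √μ₂ (n + 1) ^ 2)) ≤
          2 * a * (dispSymbol μ₂ ω - a * Real.cot (a * √μ₂)) / (ω ^ 2 + a ^ 2) := by
      refine le_trans ?_ (Monotone.ge_of_tendsto ?_ (tendsto_sum_superCoeff hμ₂ ha hah ω) (N + 1))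
      · rw [Finset.sum_range_succ']
        linarith [hterm 0]
      · exact monotone_nat_of_le_succ fun n => by
          rw [Finset.sum_range_succ]; linarith [hterm n]
    have h0 : 0 ≤ ∑ n ∈ Finset.range N, superCoeff √μ₂ a (n + 1) *
        (2 * stripFreq √μ₂ (n + 1) / (ω ^ 2 + stripFreq √μ₂ (n + 1) ^ 2)) :=
      Finset.sum_nonneg fun n _ => hterm _
    rw [Real.norm_of_nonneg (mul_nonneg (by positivity) h0), Real.norm_of_nonneg (by positivity),
      one_div_mul_eq_div, div_le_iff₀ (by positivity)]
    refine hle.trans ?_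
    rw [div_mul_eq_mul_div]
    gcongr
    linarith
  · have hsub : ∀ F F' : Lp ℂ 2 (volume : Measure ℝ),
        (𝓕 (F - F') : Lp ℂ 2 (volume : Measure ℝ)) = 𝓕 F - 𝓕 F' :=
      (Lp.fourierTransformₗᵢ ℝ ℂ).map_sub
    rw [hsub, hsub, FourierTransform.fourier_smul, FourierTransform.fourier_smul]
    filter_upwards [ae_all_iff.2 hH, ae_all_iff.2 hK, fourier_expDecay ha, fourier_expDecay hα,
      hG, hG₁, Lp.coeFn_sub (𝓕 (expDecay a ha) - (f : ℂ) • 𝓕 G) ((superCoeff √μ₂ a 0 : ℂ) • 𝓕 G₁),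
      Lp.coeFn_sub (𝓕 (expDecay a ha)) ((f : ℂ) • 𝓕 G), Lp.coeFn_smul (f : ℂ) (𝓕 G),
      Lp.coeFn_smul (superCoeff √μ₂ a 0 : ℂ) (𝓕 G₁)] with y h1 h2 h3 h4 h5 h6 h7 h8 h9 h10
    rw [h7, Pi.sub_apply, h8, Pi.sub_apply, h9, h10, Pi.smul_apply, Pi.smul_apply, h5, h6, h3, h4]
    simp only [h2, h1, smul_eq_mul, ← Complex.ofReal_mul, ← Complex.ofReal_sub]
    refine (Complex.continuous_ofReal.tendsto _).comp ?_
    generalize 2 * Real.pi * y = ω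
    have hs := dispSymbol_nonneg hμ₂ ω
    have key := (((tendsto_sum_superCoeff hμ₂ ha hah ω).comp (tendsto_add_atTop_nat 1)).sub_const
      (superCoeff √μ₂ a 0 * (2 * stripFreq √μ₂ 0 / (ω ^ 2 + stripFreq √μ₂ 0 ^ 2)))).const_mul
      (1 / (κ + dispSymbol μ₂ ω))
    convert key using 2
    · rw [Function.comp_apply, Finset.sum_range_succ', add_sub_cancel_right]
    · have h1 : κ + dispSymbol μ₂ ω ≠ 0 := by positivity
      have h2 : ω ^ 2 + stripFreq √μ₂ 0 ^ 2 ≠ 0 := by positivity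
      rw [hf]
      field_simp
      ring

/-! ### Comparison arguments and decay for the scalar equation -/

theorem memLp_linear_combination {f g : ℝ → ℝ} (hf : MemLp (fun x => (f x : ℂ)) 2)
    (hg : MemLp (fun x => (g x : ℂ)) 2) (c d : ℝ) :
    MemLp (fun x => ((c * f x + d * g x : ℝ) : ℂ)) 2 :=
  ((hf.const_mul (c : ℂ)).add (hg.const_mul (d : ℂ))).ae_eq (.of_forall fun x => by simp)

theorem toLp_linear_combination {f g h : ℝ → ℝ} (hf : MemLp (fun x => (f x : ℂ)) 2)
    (hg : MemLp (fun x => (g x : ℂ)) 2) (hh : MemLp (fun x => (h x : ℂ)) 2) {c d : ℝ}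
    (hfg : ∀ᵐ x, h x = c * f x + d * g x) :
    hh.toLp _ = (c : ℂ) • hf.toLp _ + (d : ℂ) • hg.toLp _ := by
  rw [← MemLp.toLp_const_smul, ← MemLp.toLp_const_smul, ← MemLp.toLp_add, MemLp.toLp_eq_toLp_iff]
  filter_upwards [hfg] with x hx
  simp [hx]

theorem HasSymbol.linear_combination {m f g : ℝ → ℝ} {hf : MemLp (fun x => (f x : ℂ)) 2}
    {hg : MemLp (fun x => (g x : ℂ)) 2} {F G : Lp ℂ 2 (volume : Measure ℝ)}
    (hF : HasSymbol m (hf.toLp _) F) (hG : HasSymbol m (hg.toLp _) G) (c d : ℝ)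
    {hfg : MemLp (fun x => ((c * f x + d * g x : ℝ) : ℂ)) 2} :
    HasSymbol m (hfg.toLp _) ((c : ℂ) • F + (d : ℂ) • G) := by
  rw [toLp_linear_combination hf hg hfg (.of_forall fun _ => rfl)]
  exact (hF.smul _).add (hG.smul _)

theorem re_linear_combination_ae (c d : ℝ) (F G : Lp ℂ 2 (volume : Measure ℝ)) :
    ∀ᵐ x, (((c : ℂ) • F + (d : ℂ) • G : Lp ℂ 2 (volume : Measure ℝ)) x).re =
      c * (F x).re + d * (G x).re := by
  filter_upwards [Lp.coeFn_add ((c : ℂ) • F) ((d : ℂ) • G), Lp.coeFn_smul (c : ℂ) F,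
    Lp.coeFn_smul (d : ℂ) G] with x h1 h2 h3
  rw [h1, Pi.add_apply, h2, h3]
  simp

/-- Comparison: if `|f| ≤ g` then `|m(D) f| ≤ m(D) g` for a positive multiplier `m`. -/
theorem IsPositiveMultiplier.norm_le_re {m f g : ℝ → ℝ} (hm : IsPositiveMultiplier m)
    {hf : MemLp (fun x => (f x : ℂ)) 2} {hg : MemLp (fun x => (g x : ℂ)) 2}
    {F G : Lp ℂ 2 (volume : Measure ℝ)} (hfg : ∀ᵐ x, |f x| ≤ g x)
    (hF : HasSymbol m (hf.toLp _) F) (hG : HasSymbol m (hg.toLp _) G) :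
    ∀ᵐ x, ‖F x‖ ≤ (G x).re := by
  have h1 : AENonneg (G + F) := by
    refine hm.nonneg (hG.add hF) ?_
    filter_upwards [hfg, hf.coeFn_toLp, hg.coeFn_toLp, Lp.coeFn_add (hg.toLp _) (hf.toLp _)]
      with x h1 h2 h3 h4
    rw [h4, Pi.add_apply, h2, h3, ← Complex.ofReal_add]
    exact Complex.zero_le_real.2 (by linarith [neg_abs_le (f x)])
  have h2 : AENonneg (G - F) := by
    refine hm.nonneg (hG.sub hF) ?_
    filter_upwards [hfg, hf.coeFn_toLp, hg.coeFn_toLp, Lp.coeFn_sub (hg.toLp _) (hf.toLp _)]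
      with x h1 h2 h3 h4
    rw [h4, Pi.sub_apply, h2, h3, ← Complex.ofReal_sub]
    exact Complex.zero_le_real.2 (by linarith [le_abs_self (f x)])
  filter_upwards [h1, h2, Lp.coeFn_add G F, Lp.coeFn_sub G F] with x k1 k2 k3 k4
  rw [k3, Pi.add_apply, Complex.nonneg_iff, Complex.add_re, Complex.add_im] at k1
  rw [k4, Pi.sub_apply, Complex.nonneg_iff, Complex.sub_re, Complex.sub_im] at k2
  have him : (F x).im = 0 := by linarith [k1.2, k2.2]
  have : F x = ((F x).re : ℂ) := Complex.ext (by simp) (by simp [him])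
  rw [this, Complex.norm_real, Real.norm_eq_abs, abs_le]
  constructor <;> linarith [k1.1, k2.1]

/-- If `z ≤ δ m(D) z` and `δ m(D)` is positive and a strict contraction of `L²`, then `z ≤ 0`: the
positive part satisfies `z⁺ ≤ δ m(D) z⁺`, so its norm vanishes. -/
theorem IsPositiveMultiplier.ae_nonpos_of_le {m : ℝ → ℝ} (hm : IsPositiveMultiplier m) {C δ : ℝ}
    (hC : ∀ y, |m y| ≤ C) (hδ : 0 ≤ δ) (hδC : δ * C < 1) {z : ℝ → ℝ}
    {hz : MemLp (fun x => (z x : ℂ)) 2} {Z : Lp ℂ 2 (volume : Measure ℝ)}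
    (hZ : HasSymbol m (hz.toLp _) Z) (hle : ∀ᵐ x, z x ≤ δ * (Z x).re) : ∀ᵐ x, z x ≤ 0 := by
  have hp : MemLp (fun x => ((max (z x) 0 : ℝ) : ℂ)) 2 := (hz.re.pos_part).ofReal
  obtain ⟨P, hP⟩ := hm.exists_hasSymbol (hp.toLp _)
  have hP0 : AENonneg P := by
    refine hm.nonneg hP ?_
    filter_upwards [hp.coeFn_toLp] with x hx
    rw [hx]
    exact Complex.zero_le_real.2 (le_max_right _ _)
  have hPZ : AENonneg (P - Z) := by
    refine hm.nonneg (hP.sub hZ) ?_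
    filter_upwards [hp.coeFn_toLp, hz.coeFn_toLp, Lp.coeFn_sub (hp.toLp _) (hz.toLp _)]
      with x h1 h2 h3
    rw [h3, Pi.sub_apply, h1, h2, ← Complex.ofReal_sub]
    exact Complex.zero_le_real.2 (sub_nonneg.2 (le_max_left _ _))
  have hn : ‖hp.toLp _‖ ≤ δ * ‖P‖ := by
    refine Lp.norm_le_mul_norm_of_ae_le_mul ?_
    filter_upwards [hp.coeFn_toLp, hP0, hPZ, hle, Lp.coeFn_sub P Z] with x h1 h2 h3 h4 h5
    rw [h5, Pi.sub_apply, Complex.nonneg_iff, Complex.sub_re] at h3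
    rw [h1, Complex.norm_real, Real.norm_of_nonneg (le_max_right _ _)]
    refine max_le ?_ (by positivity)
    exact h4.trans (mul_le_mul_of_nonneg_left
      (by linarith [h3.1, Complex.re_le_norm (P x)]) hδ)
  have h0 : ‖hp.toLp _‖ = 0 := by
    have h1 := hP.norm_le hC
    have h2 : ‖hp.toLp _‖ ≤ (δ * C) * ‖hp.toLp _‖ := by
      rw [mul_assoc]; exact hn.trans (mul_le_mul_of_nonneg_left h1 hδ)
    nlinarith [norm_nonneg (hp.toLp _)]
  rw [norm_eq_zero] at h0
  filter_upwards [hp.coeFn_toLp, Lp.coeFn_zero ℂ 2 (volume : Measure ℝ)] with x h1 h2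
  rw [h0, h2] at h1
  have h3 : max (z x) 0 = 0 := by
    simpa using h1.symm
  exact h3 ▸ le_max_left (z x) 0

theorem abs_one_div_add_dispSymbol_le {κ μ₂ : ℝ} (hκ : 0 < κ) (hμ₂ : 0 < μ₂) (y : ℝ) :
    |1 / (κ + dispSymbol μ₂ y)| ≤ 1 / κ := by
  have := dispSymbol_nonneg hμ₂ y
  rw [abs_of_nonneg (by positivity)]
  gcongr
  linarith

theorem exists_const_le_exp {f : ℝ → ℝ} {M : ℝ} (hM : ∀ x, |f x| ≤ M) {R a : ℝ} (ha : 0 < a) :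
    ∃ C, 0 ≤ C ∧ ∀ x, |x| ≤ R → |f x| ≤ C * Real.exp (-a * |x|) := by
  have hM0 : 0 ≤ M := (abs_nonneg _).trans (hM 0)
  refine ⟨M * Real.exp (a * R), by positivity, fun x hx => ?_⟩
  rw [mul_assoc, ← Real.exp_add]
  refine (hM x).trans (le_mul_of_one_le_right hM0 (Real.one_le_exp ?_))
  nlinarith

/-- Where `ν` is small, it is at most twice `ν - k ν²`. -/
theorem exists_abs_le_add {ν : ℝ → ℝ} {k M a : ℝ} (ha : 0 < a) (hM : ∀ x, |ν x| ≤ M)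
    (hsmall : ∀ δ > 0, ∃ R, ∀ x, R ≤ |x| → |ν x| ≤ δ) :
    ∃ C, 0 ≤ C ∧ ∀ x, |ν x| ≤ C * Real.exp (-a * |x|) + 2 * |ν x - k * ν x ^ 2| := by
  obtain ⟨R, hR⟩ := hsmall (1 / (2 * (|k| + 1))) (by positivity)
  obtain ⟨C, hC0, hC⟩ := exists_const_le_exp hM (R := R) ha
  refine ⟨C, hC0, fun x => ?_⟩
  rcases le_total |x| R with h | h
  · have := abs_nonneg (ν x - k * ν x ^ 2)
    linarith [hC x h]
  · have h1 : |k| * |ν x| ≤ 1 / 2 := by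
      have := hR x h
      rw [le_div_iff₀ (by positivity)] at this
      nlinarith [abs_nonneg (ν x), abs_nonneg k]
    have h2 : |ν x| - |k| * |ν x| * |ν x| ≤ |ν x - k * ν x ^ 2| := by
      have := abs_sub_abs_le_abs_sub (ν x) (k * ν x ^ 2)
      rw [abs_mul, abs_pow, sq, ← mul_assoc] at this
      exact this
    have h3 : 0 ≤ C * Real.exp (-a * |x|) := by positivity
    nlinarith [abs_nonneg (ν x)]

section Decay

variable {κ μ₂ k C M : ℝ} {ν q : ℝ → ℝ}

/-- Decay at the rate `α_0 / 2 = π / (2 √μ₂)`. There the cotangent vanishes, so that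
`m(D) exp (-a |x|) ≤ exp (-a |x|) / κ`, and `ν² ≤ δ |ν|` near infinity makes
`|ν| - D exp (-a |x|)`, for large `D`, a subsolution as in `ae_nonpos_of_le`. -/
theorem decay_half_rate (hκ : 0 < κ) (hμ₂ : 0 < μ₂) (hC : 0 ≤ C)
    (hν : MemLp (fun x => (ν x : ℂ)) 2) {hq : MemLp (fun x => (q x : ℂ)) 2}
    {hu : MemLp (fun x => ((ν x - k * ν x ^ 2 : ℝ) : ℂ)) 2}
    (hsym : HasSymbol (fun y => 1 / (κ + dispSymbol μ₂ y)) (hq.toLp _) (hu.toLp _))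
    (hqν : ∀ x, |q x| ≤ C * ν x ^ 2) (hM : ∀ x, |ν x| ≤ M)
    (hsmall : ∀ δ > 0, ∃ R, ∀ x, R ≤ |x| → |ν x| ≤ δ) :
    ∃ D, 0 ≤ D ∧ ∀ᵐ x, |ν x| ≤ D * Real.exp (-(stripFreq √μ₂ 0 / 2) * |x|) := by
  have hh : 0 < √μ₂ := Real.sqrt_pos.2 hμ₂
  have hα := stripFreq_pos hh 0
  have hm := isPositiveMultiplier_one_div_add_dispSymbol hκ hμ₂
  set a := stripFreq √μ₂ 0 / 2 with ha_def
  have ha : 0 < a := by positivity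
  have hah : a * √μ₂ = Real.pi / 2 := by
    rw [ha_def, stripFreq_zero]; field_simp
  obtain ⟨P, hP⟩ := hm.exists_hasSymbol (expDecay a ha)
  obtain ⟨P₁, hP₁⟩ := hm.exists_hasSymbol (expDecay _ hα)
  have hcot : Real.cot (a * √μ₂) = 0 := by rw [hah, Real.cot_eq_cos_div_sin]; simp
  have hah' : a * √μ₂ < Real.pi := by rw [hah]; linarith [Real.pi_pos]
  have hsup := expDecay_supersolution hκ hμ₂ ha hah' (by rw [hcot]; linarith) hP hP₁
  have hP₁0 := hm.nonneg hP₁ (expDecay_nonneg _)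
  have hPle : ∀ᵐ x, κ * (P x).re ≤ Real.exp (-a * |x|) := by
    rw [hcot, mul_zero, add_zero] at hsup
    filter_upwards [hsup, hP₁0, coeFn_expDecay ha,
      Lp.coeFn_sub (expDecay a ha - (κ : ℂ) • P) ((superCoeff √μ₂ a 0 : ℂ) • P₁),
      Lp.coeFn_sub (expDecay a ha) ((κ : ℂ) • P), Lp.coeFn_smul (κ : ℂ) P,
      Lp.coeFn_smul (superCoeff √μ₂ a 0 : ℂ) P₁] with x h1 h2 h3 h4 h5 h6 h7
    rw [h4, Pi.sub_apply, h5, Pi.sub_apply, h6, h7, h3] at h1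
    have h8 := (Complex.nonneg_iff.1 h1).1
    have h9 := (Complex.nonneg_iff.1 h2).1
    have h10 := superCoeff_pos hh ha hah' 0
    simp only [Pi.smul_apply, smul_eq_mul, Complex.sub_re, Complex.re_ofReal_mul,
      Complex.ofReal_re] at h8
    nlinarith
  -- Near infinity `ν` is so small that `C ν² ≤ (κ / 4) |ν|`; the factor 2 of `exists_abs_le_add`
  -- turns `κ / 4` into `κ / 2`, which contracts against `‖m(D)‖ ≤ 1 / κ`.
  obtain ⟨R, hR⟩ := hsmall (κ / (4 * (C + 1))) (by positivity)
  obtain ⟨C₁, hC₁0, hC₁⟩ : ∃ C₁, 0 ≤ C₁ ∧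
      ∀ x, |q x| ≤ C₁ * Real.exp (-a * |x|) + κ / 4 * |ν x| := by
    have hqM : ∀ x, |q x| ≤ C * M ^ 2 := fun x => (hqν x).trans (by
      rw [← sq_abs]; gcongr; exact hM x)
    obtain ⟨C₁, hC₁0, hC₁⟩ := exists_const_le_exp hqM (R := R) ha
    refine ⟨C₁, hC₁0, fun x => ?_⟩
    rcases le_total |x| R with h | h
    · have := hC₁ x h
      have : 0 ≤ κ / 4 * |ν x| := by positivity
      linarith
    · have h1 := hR x h
      rw [le_div_iff₀ (by positivity)] at h1
      have h2 : C * |ν x| ≤ κ / 4 := by nlinarith [abs_nonneg (ν x)]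
      have h3 : 0 ≤ C₁ * Real.exp (-a * |x|) := by positivity
      have h4 := hqν x
      rw [← sq_abs] at h4
      nlinarith [abs_nonneg (ν x)]
  obtain ⟨C₂, hC₂0, hC₂⟩ := exists_abs_le_add (k := k) ha hM hsmall
  set D := 2 * (C₂ + 2 * C₁ / κ) with hD
  have hD0 : 0 ≤ D := by positivity
  refine ⟨D, hD0, ?_⟩
  have hV : MemLp (fun x => ((|ν x| : ℝ) : ℂ)) 2 := (hν.re.abs).ofReal
  have hψ := memLp_exp_neg_mul_abs ha
  obtain ⟨Q, hQ⟩ := hm.exists_hasSymbol (hV.toLp _)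
  have hg : MemLp (fun x => ((C₁ * Real.exp (-a * |x|) + κ / 4 * |ν x| : ℝ) : ℂ)) 2 :=
    memLp_linear_combination hψ hV C₁ (κ / 4)
  have hz : MemLp (fun x => ((1 * |ν x| + (-D) * Real.exp (-a * |x|) : ℝ) : ℂ)) 2 :=
    memLp_linear_combination hV hψ 1 (-D)
  have hule := hm.norm_le_re (hg := hg) (.of_forall hC₁) hsym
    (HasSymbol.linear_combination (hf := hψ) hP hQ C₁ (κ / 4))
  have hZ := HasSymbol.linear_combination (hfg := hz) hQ (hg := hψ) hP 1 (-D)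
  have hfin := hm.ae_nonpos_of_le (abs_one_div_add_dispSymbol_le hκ hμ₂) (δ := κ / 2)
    (by positivity) (by field_simp; norm_num) hZ (by
      filter_upwards [hule, hPle, hu.coeFn_toLp, re_linear_combination_ae C₁ (κ / 4) P Q,
        re_linear_combination_ae 1 (-D) Q P] with x h1 h2 h3 h4 h5
      rw [h3, Complex.norm_real, Real.norm_eq_abs, h4] at h1
      rw [h5]
      have h6 := hC₂ x
      have h7 : (C₂ + 2 * C₁ / κ) * κ = C₂ * κ + 2 * C₁ := by field_simp
      have h8 : 2 * C₁ * (P x).re ≤ 2 * C₁ / κ * Real.exp (-a * |x|) := by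
        rw [div_mul_eq_mul_div, le_div_iff₀ hκ]
        nlinarith
      have h9 : κ / 2 * (D * (P x).re) ≤ D / 2 * Real.exp (-a * |x|) := by nlinarith
      have h10 : D / 2 = C₂ + 2 * C₁ / κ := by rw [hD]; ring
      rw [h10] at h9
      have h11 : D = 2 * (C₂ + 2 * C₁ / κ) := hD
      nlinarith)
  filter_upwards [hfin] with x hx
  linarith

/-- Decay at every rate `a < π / √μ₂` with `κ + a cot (a √μ₂) ≥ 0`: by `decay_half_rate` the quadratic
right-hand side is `O(exp (-α_0 |x|))`, whose image is dominated by `exp (-a |x|)`. -/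
theorem decay_sharp_rate (hκ : 0 < κ) (hμ₂ : 0 < μ₂) (hC : 0 ≤ C)
    (hν : MemLp (fun x => (ν x : ℂ)) 2) {hq : MemLp (fun x => (q x : ℂ)) 2}
    {hu : MemLp (fun x => ((ν x - k * ν x ^ 2 : ℝ) : ℂ)) 2}
    (hsym : HasSymbol (fun y => 1 / (κ + dispSymbol μ₂ y)) (hq.toLp _) (hu.toLp _))
    (hqν : ∀ x, |q x| ≤ C * ν x ^ 2) (hM : ∀ x, |ν x| ≤ M)
    (hsmall : ∀ δ > 0, ∃ R, ∀ x, R ≤ |x| → |ν x| ≤ δ)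
    {a : ℝ} (ha : 0 < a) (hah : a * √μ₂ < Real.pi) (hF : 0 ≤ κ + a * Real.cot (a * √μ₂)) :
    ∃ D, 0 ≤ D ∧ ∀ᵐ x, |ν x| ≤ D * Real.exp (-a * |x|) := by
  have hh : 0 < √μ₂ := Real.sqrt_pos.2 hμ₂
  have hα := stripFreq_pos hh 0
  have hm := isPositiveMultiplier_one_div_add_dispSymbol hκ hμ₂
  obtain ⟨D, hD0, hD⟩ := decay_half_rate hκ hμ₂ hC hν hsym hqν hM hsmall
  obtain ⟨P, hP⟩ := hm.exists_hasSymbol (expDecay a ha)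
  obtain ⟨P₁, hP₁⟩ := hm.exists_hasSymbol (expDecay _ hα)
  have hsup := expDecay_supersolution hκ hμ₂ ha hah hF hP hP₁
  have hP0 := hm.nonneg hP (expDecay_nonneg _)
  set d := superCoeff √μ₂ a 0 with hd_def
  have hd : 0 < d := superCoeff_pos hh ha hah 0
  set f := κ + a * Real.cot (a * √μ₂) with hf
  have hP₁le : ∀ᵐ x, d * (P₁ x).re ≤ Real.exp (-a * |x|) := by
    filter_upwards [hsup, hP0, coeFn_expDecay ha,
      Lp.coeFn_sub (expDecay a ha - (f : ℂ) • P) ((d : ℂ) • P₁),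
      Lp.coeFn_sub (expDecay a ha) ((f : ℂ) • P), Lp.coeFn_smul (f : ℂ) P,
      Lp.coeFn_smul (d : ℂ) P₁] with x h1 h2 h3 h4 h5 h6 h7
    rw [h4, Pi.sub_apply, h5, Pi.sub_apply, h6, h7, h3] at h1
    have h8 := (Complex.nonneg_iff.1 h1).1
    have h9 := (Complex.nonneg_iff.1 h2).1
    simp only [Pi.smul_apply, smul_eq_mul, Complex.sub_re, Complex.re_ofReal_mul,
      Complex.ofReal_re] at h8
    nlinarith
  have hψ := memLp_exp_neg_mul_abs hα
  have hg : MemLp (fun x =>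
      ((C * D ^ 2 * Real.exp (-stripFreq √μ₂ 0 * |x|) + 0 * Real.exp (-stripFreq √μ₂ 0 * |x|) : ℝ)
        : ℂ)) 2 :=
    memLp_linear_combination hψ hψ (C * D ^ 2) 0
  have hqle : ∀ᵐ x, |q x| ≤ C * D ^ 2 * Real.exp (-stripFreq √μ₂ 0 * |x|) +
      0 * Real.exp (-stripFreq √μ₂ 0 * |x|) := by
    filter_upwards [hD] with x hx
    have e : Real.exp (-stripFreq √μ₂ 0 * |x|) =
        Real.exp (-(stripFreq √μ₂ 0 / 2) * |x|) ^ 2 := by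
      rw [← Real.exp_nat_mul]; congr 1; push_cast; ring
    rw [zero_mul, add_zero, e, mul_assoc, ← mul_pow]
    refine (hqν x).trans ?_
    rw [← sq_abs]
    gcongr
  have hule := hm.norm_le_re (hg := hg) hqle hsym
    (HasSymbol.linear_combination (hf := hψ) hP₁ (hg := hψ) hP₁ (C * D ^ 2) 0)
  obtain ⟨C₂, hC₂0, hC₂⟩ := exists_abs_le_add (k := k) ha hM hsmall
  refine ⟨C₂ + 2 * (C * D ^ 2 / d), by positivity, ?_⟩
  filter_upwards [hule, hP₁le, hu.coeFn_toLp, re_linear_combination_ae (C * D ^ 2) 0 P₁ P₁]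
    with x h1 h2 h3 h4
  rw [h3, Complex.norm_real, Real.norm_eq_abs, h4] at h1
  have h5 : C * D ^ 2 * (P₁ x).re ≤ C * D ^ 2 / d * Real.exp (-a * |x|) := by
    rw [div_mul_eq_mul_div, le_div_iff₀ hd, mul_assoc, mul_comm _ d]
    gcongr
  linarith [hC₂ x]

end Decay

/-! ### The first root, and reduction of the system to the scalar equation -/

/-- The first root lies in `(π/2, π)`: on `(0, π/2)` the tangent is positive, and on `[π/2, π]` the roots
are the zeros of the continuous function `η cos η + θ sin η`, which changes sign. -/
theorem exists_isFirstRoot {θ : ℝ} (hθ : 0 < θ) :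
    ∃ η, IsFirstRoot θ η ∧ Real.pi / 2 < η ∧ η < Real.pi := by
  have hπ := Real.pi_pos
  set g : ℝ → ℝ := fun η => η * Real.cos η + θ * Real.sin η with hg
  have hgc : Continuous g := by fun_prop
  set S : Set ℝ := Set.Icc (Real.pi / 2) Real.pi ∩ g ⁻¹' {0} with hS
  have hSne : S.Nonempty := by
    have h0 : (0 : ℝ) ∈ Set.Icc (g Real.pi) (g (Real.pi / 2)) := by
      simp [hg, hθ.le, hπ.le]
    obtain ⟨x, hx, hx0⟩ := intermediate_value_Icc' (by linarith) hgc.continuousOn h0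
    exact ⟨x, hx, hx0⟩
  have hScpt : IsCompact S := isCompact_Icc.inter_right (isClosed_singleton.preimage hgc)
  obtain ⟨η, ⟨⟨h1, h2⟩, h0⟩, hmin⟩ := hScpt.exists_isLeast hSne
  have h0' : η * Real.cos η + θ * Real.sin η = 0 := h0
  have h1' : Real.pi / 2 < η := by
    refine lt_of_le_of_ne h1 fun h => ?_
    rw [← h] at h0'
    simp [hθ.ne'] at h0'
  have h2' : η < Real.pi := by
    refine lt_of_le_of_ne h2 fun h => ?_
    rw [h] at h0'
    simp [hπ.ne'] at h0'
  have hroot : ∀ t : ℝ, Real.cos t ≠ 0 → (-t = θ * Real.tan t ↔ g t = 0) := fun t ht => by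
    rw [Real.tan_eq_sin_div_cos, hg]
    constructor
    · intro h
      field_simp at h
      linarith
    · intro h
      field_simp
      linarith
  have hcos : Real.cos η ≠ 0 := (Real.cos_neg_of_pi_div_two_lt_of_lt h1' (by linarith)).ne
  refine ⟨η, ⟨⟨by linarith, hcos, (hroot η hcos).2 h0⟩, fun t ⟨ht, htc, hte⟩ => ?_⟩, h1', h2'⟩
  by_contra hlt
  rw [not_le] at hlt
  rcases lt_or_ge t (Real.pi / 2) with h | h
  · have := Real.tan_pos_of_pos_of_lt_pi_div_two ht h
    nlinarith
  · exact absurd (hmin ⟨⟨h, by linarith⟩, (hroot t htc).1 hte⟩) (not_le.2 hlt)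

theorem MemH1.exists_abs_le {f : ℝ → ℝ} (hf : MemH1 f) {δ : ℝ} (hδ : 0 < δ) :
    ∃ R, ∀ x, R ≤ |x| → |f x| ≤ δ := by
  have h := hf.tendsto_zero.abs
  rw [abs_zero] at h
  obtain ⟨K, hK, hKf⟩ := mem_cocompact.1 (h (Iio_mem_nhds hδ))
  obtain ⟨R, hR⟩ := hK.isBounded.subset_closedBall 0
  refine ⟨R + 1, fun x hx => (hKf (?_ : x ∉ K)).le⟩
  intro hxK
  have := hR hxK
  rw [mem_closedBall_zero_iff, Real.norm_eq_abs] at this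
  linarith

theorem MemH1.bounded {f : ℝ → ℝ} (hf : MemH1 f) : ∃ M, ∀ x, |f x| ≤ M := by
  obtain ⟨R, hR⟩ := hf.exists_abs_le one_pos
  obtain ⟨M, hM⟩ := (isCompact_closedBall (0 : ℝ) R).exists_bound_of_continuousOn hf.1.continuousOn
  refine ⟨max M 1, fun x => ?_⟩
  rcases le_total |x| R with h | h
  · exact (hM x (by rwa [mem_closedBall_zero_iff, Real.norm_eq_abs])).trans (le_max_left _ _)
  · exact (hR x h).trans (le_max_right _ _)

theorem memLp_mul_of_bounded {f g : ℝ → ℝ} {M : ℝ} (hf : Continuous f) (hM : ∀ x, |f x| ≤ M)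
    (hg : MemLp (fun x => (g x : ℂ)) 2) : MemLp (fun x => ((f x * g x : ℝ) : ℂ)) 2 := by
  refine MemLp.of_le_mul (c := M) hg ?_ (.of_forall fun x => ?_)
  · refine ((by fun_prop : Continuous fun x => (f x : ℂ)).aestronglyMeasurable.mul hg.1).congr
      (.of_forall fun x => ?_)
    simp
  · rw [Complex.ofReal_mul, norm_mul, Complex.norm_real, Real.norm_eq_abs]
    gcongr
    exact hM x

theorem fourier_toLp_linear_combination {f g h : ℝ → ℝ} (hf : MemLp (fun x => (f x : ℂ)) 2)
    (hg : MemLp (fun x => (g x : ℂ)) 2) (hh : MemLp (fun x => (h x : ℂ)) 2) {c d : ℝ}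
    (hfg : ∀ᵐ x, h x = c * f x + d * g x) :
    ∀ᵐ y, (𝓕 (hh.toLp _) : Lp ℂ 2 (volume : Measure ℝ)) y =
      c * (𝓕 (hf.toLp _) : Lp ℂ 2 (volume : Measure ℝ)) y +
        d * (𝓕 (hg.toLp _) : Lp ℂ 2 (volume : Measure ℝ)) y := by
  rw [toLp_linear_combination hf hg hh hfg, FourierTransform.fourier_add,
    FourierTransform.fourier_smul, FourierTransform.fourier_smul]
  filter_upwards [Lp.coeFn_add ((c : ℂ) • 𝓕 (hf.toLp _)) ((d : ℂ) • 𝓕 (hg.toLp _)),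
    Lp.coeFn_smul (c : ℂ) (𝓕 (hf.toLp _)), Lp.coeFn_smul (d : ℂ) (𝓕 (hg.toLp _))] with y h1 h2 h3
  rw [h1, Pi.add_apply, h2, h3]
  simp

section Reduction

variable {γ β μ μ₂ ε c : ℝ} {ξ ν : ℝ → ℝ}

/-- Elimination of `ξ`. On the Fourier side `𝒵 ν - c 𝒲 ξ = (A + B s) ν̂ - e (1 + b s) (ν²)^` with
`A, B > 0`; writing `1 + b s = b (κ + s) + (1 - b κ)` with `κ = A / B` moves the part of `𝒲 ν²` that
loses a derivative into the algebraic term `k ν²`. -/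
theorem IsSolitaryWave.exists_reduced (hγ₀ : 0 < γ) (hγ₁ : γ < 1) (hβ : 1 < β) (hμ : 0 < μ)
    (hε : 0 < ε) (hc : c ^ 2 < (1 - γ) * (β - 1) / (γ * β))
    (h : IsSolitaryWave γ β μ μ₂ ε c ξ ν) :
    ∃ (κ k C C' : ℝ) (q : ℝ → ℝ) (hq : MemLp (fun x => (q x : ℂ)) 2)
      (hu : MemLp (fun x => ((ν x - k * ν x ^ 2 : ℝ) : ℂ)) 2),
      γ / ((β - 1) * √μ) ≤ κ ∧ 0 ≤ C ∧ 0 ≤ C' ∧ (∀ x, |q x| ≤ C * ν x ^ 2) ∧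
      (∀ x, |ξ x| ≤ C' * |ν x|) ∧
      HasSymbol (fun y => κ + dispSymbol μ₂ y) (hu.toLp _) (hq.toLp _) := by
  obtain ⟨M, hM⟩ := h.memH1_ν.bounded
  have hM0 : 0 ≤ M := (abs_nonneg _).trans (hM 0)
  obtain ⟨w, z, ⟨hξ2, hw2, hw⟩, ⟨hν2, hz2, hz⟩, heq⟩ := h.first_eq
  have hs : 0 < √μ := Real.sqrt_pos.2 hμ
  have hγ1 : 0 < 1 - γ := by linarith
  have hβ1 : 0 < β - 1 := by linarith
  set t := c ^ 2 / (1 - γ) with ht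
  have ht0 : 0 ≤ t := by positivity
  have htlt : t * (γ * β) < β - 1 := by
    rw [lt_div_iff₀ (by positivity)] at hc
    rw [ht, div_mul_eq_mul_div, div_lt_iff₀ hγ1]
    linarith
  set A := 1 / γ - t with hA
  set B := ((β - 1) / γ ^ 2 - t * β / γ) * √μ with hB
  have hB0 : 0 < B := by
    refine mul_pos ?_ hs
    have : (β - 1) / γ ^ 2 - t * β / γ = (β - 1 - t * (γ * β)) / γ ^ 2 := by field_simp
    rw [this]
    exact div_pos (by linarith) (by positivity)
  set κ := A / B with hκ
  set b := β / γ * √μ with hb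
  set e := c * (ε / (2 * γ)) / (1 - γ) with he
  set k := e * b / B with hk
  set q : ℝ → ℝ := fun x =>
    ε / (γ * B) * (ξ x * ν x) + e * (1 - b * κ) / B * (ν x * ν x) with hq_def
  have hn2 := memLp_mul_of_bounded h.memH1_ν.1 hM hν2
  have hξν2 : MemLp (fun x => ((ξ x * ν x : ℝ) : ℂ)) 2 := by
    simpa only [mul_comm] using memLp_mul_of_bounded h.memH1_ν.1 hM hξ2
  have hq : MemLp (fun x => (q x : ℂ)) 2 := memLp_linear_combination hξν2 hn2 _ _
  have hu : MemLp (fun x => ((ν x - k * ν x ^ 2 : ℝ) : ℂ)) 2 :=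
    (memLp_linear_combination hν2 hn2 1 (-k)).ae_eq (.of_forall fun x => by push_cast; ring)
  set C' := 1 / (1 - γ) * (|c| + ε / (2 * γ) * M) with hC'
  have hC'0 : 0 ≤ C' := by positivity
  have hξν : ∀ x, |ξ x| ≤ C' * |ν x| := fun x => by
    rw [h.second_eq x, abs_mul, abs_of_pos (by positivity : 0 < 1 / (1 - γ)), hC', mul_assoc]
    gcongr
    refine (abs_add_le _ _).trans ?_
    rw [abs_mul, abs_mul, abs_of_pos (by positivity : 0 < ε / (2 * γ)), add_mul, abs_pow, sq,
      ← mul_assoc]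
    gcongr
    exact hM x
  refine ⟨κ, k, ε / (γ * B) * C' + |e * (1 - b * κ) / B|, C', q, hq, hu, ?_, by positivity, hC'0,
    fun x => ?_, hξν, ?_⟩
  · rw [hκ, div_le_div_iff₀ (by positivity) hB0]
    have h1 : γ * B = ((β - 1) / γ - t * β) * √μ := by rw [hB]; field_simp
    have h2 : A * ((β - 1) * √μ) = ((β - 1) / γ - t * (β - 1)) * √μ := by rw [hA]; ring
    rw [h1, h2]
    gcongr
    linarith
  · refine (abs_add_le _ _).trans ?_
    rw [abs_mul, abs_mul (_ / B), abs_of_pos (by positivity : 0 < ε / (γ * B)), add_mul,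
      ← sq, abs_pow, sq_abs, abs_mul, mul_assoc, mul_assoc]
    have := hξν x
    have h2 : |ξ x| * |ν x| ≤ C' * ν x ^ 2 := by
      rw [← sq_abs, sq, ← mul_assoc]; gcongr
    gcongr
  · have hξ_eq := fourier_toLp_linear_combination hν2 hn2 hξ2 (c := c / (1 - γ))
      (d := ε / (2 * γ) / (1 - γ)) (.of_forall fun x => by rw [h.second_eq x]; ring)
    have hp_eq := fourier_toLp_linear_combination hw2 hz2 hξν2 (c := γ / ε * -c) (d := γ / ε) (by
      filter_upwards [heq] with x hx
      rw [mul_assoc, ← mul_add, hx]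
      field_simp)
    have hq_eq := fourier_toLp_linear_combination hξν2 hn2 hq (c := ε / (γ * B))
      (d := e * (1 - b * κ) / B) (.of_forall fun x => rfl)
    have hu_eq := fourier_toLp_linear_combination hν2 hn2 hu (c := 1) (d := -k)
      (.of_forall fun x => by ring)
    filter_upwards [hξ_eq, hp_eq, hq_eq, hu_eq, hw, hz] with y h1 h2 h3 h4 h5 h6
    rw [h3, h2, h4, h5, h6, h1]
    simp only [symbolW, symbolZ, ← hb]
    generalize (𝓕 (hν2.toLp _) : Lp ℂ 2 (volume : Measure ℝ)) y = νhat
    generalize (𝓕 (hn2.toLp _) : Lp ℂ 2 (volume : Measure ℝ)) y = nhat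
    generalize dispSymbol μ₂ (2 * Real.pi * y) = S
    -- The coefficients of `ν̂` and `(ν²)^` in the transform of `q`.
    have hcoeff_ν : ε / (γ * B) * (γ / ε * -c * ((1 + b * S) * (c / (1 - γ))) +
        γ / ε * (1 / γ * (1 + (β - 1) / γ * √μ * S))) = κ + S := by
      have h7 : ε / (γ * B) * (γ / ε * -c * ((1 + b * S) * (c / (1 - γ))) +
          γ / ε * (1 / γ * (1 + (β - 1) / γ * √μ * S))) = (A + B * S) / B := by
        have h8 : A + B * S = -c * ((1 + b * S) * (c / (1 - γ))) +
            1 / γ * (1 + (β - 1) / γ * √μ * S) := by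
          rw [hA, hB, hb, ht]
          field_simp
          ring
        rw [h8]
        field_simp
      rw [h7, add_div, mul_div_cancel_left₀ _ hB0.ne']
    have hcoeff_n : ε / (γ * B) * (γ / ε * -c * ((1 + b * S) * (ε / (2 * γ) / (1 - γ)))) +
        e * (1 - b * κ) / B = -k * (κ + S) := by
      have h7 : c * (ε / (2 * γ) / (1 - γ)) = e := by rw [he]; ring
      have h8 : ε / (γ * B) * (γ / ε * -c * ((1 + b * S) * (ε / (2 * γ) / (1 - γ)))) =
          -(1 + b * S) / B * (c * (ε / (2 * γ) / (1 - γ))) := by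
        field_simp
      rw [h8, h7, hk]
      ring
    have hcoeff_ν' := congrArg (Complex.ofReal) hcoeff_ν
    have hcoeff_n' := congrArg (Complex.ofReal) hcoeff_n
    push_cast at hcoeff_ν' hcoeff_n' ⊢
    linear_combination νhat * hcoeff_ν' + nhat * hcoeff_n'

end Reduction

end ILW

theorem theorem7p2 (γ β μ μ₂ ε : ℝ) (hγ₀ : 0 < γ) (hγ₁ : γ < 1) (hβ : 1 < β)
    (hμ : 0 < μ) (hμ₂ : 0 < μ₂) (hε : 0 < ε) :
    ∃ η₁ : ℝ, ILW.IsFirstRoot (γ * √μ₂ / ((β - 1) * √μ)) η₁ ∧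
      ∀ (c : ℝ), c ^ 2 < (1 - γ) * (β - 1) / (γ * β) →
        ∀ (ξ ν : ℝ → ℝ), ILW.IsSolitaryWave γ β μ μ₂ ε c ξ ν →
          ∃ N₁ : ℝ, 0 < N₁ ∧ ∀ x : ℝ,
            Real.exp (η₁ / √μ₂ * |x|) * |ξ x| ≤ N₁ ∧
            Real.exp (η₁ / √μ₂ * |x|) * |ν x| ≤ N₁ := by
  have hs : 0 < √μ := Real.sqrt_pos.2 hμ
  have hh : 0 < √μ₂ := Real.sqrt_pos.2 hμ₂
  have hβ1 : 0 < β - 1 := by linarith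
  obtain ⟨η₁, hη, hη1, hη2⟩ := ILW.exists_isFirstRoot
    (θ := γ * √μ₂ / ((β - 1) * √μ)) (by positivity)
  refine ⟨η₁, hη, fun c hc ξ ν h => ?_⟩
  obtain ⟨κ, k, C, C', q, hq, hu, hκ, hC, hC', hqν, hξν, hsym⟩ :=
    h.exists_reduced hγ₀ hγ₁ hβ hμ hε hc
  have hκ0 : 0 < κ := lt_of_lt_of_le (by positivity) hκ
  obtain ⟨M, hM⟩ := h.memH1_ν.bounded
  have hη0 : 0 < η₁ := by linarith [Real.pi_pos]
  have hinv : ILW.HasSymbol (fun y => 1 / (κ + ILW.dispSymbol μ₂ y)) (hq.toLp _) (hu.toLp _) := by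
    filter_upwards [hsym] with y hy
    have : κ + ILW.dispSymbol μ₂ (2 * Real.pi * y) ≠ 0 := by
      have := ILW.dispSymbol_nonneg hμ₂ (2 * Real.pi * y)
      positivity
    rw [hy, ← mul_assoc, ← Complex.ofReal_mul, one_div_mul_cancel this, Complex.ofReal_one, one_mul]
  have hah : η₁ / √μ₂ * √μ₂ = η₁ := div_mul_cancel₀ _ hh.ne'
  have hF : 0 ≤ κ + η₁ / √μ₂ * Real.cot (η₁ / √μ₂ * √μ₂) := by
    obtain ⟨-, hcos, hroot⟩ := hη.1
    have hcos' : Real.cos η₁ < 0 :=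
      Real.cos_neg_of_pi_div_two_lt_of_lt hη1 (by linarith)
    have hsin : 0 < Real.sin η₁ := Real.sin_pos_of_pos_of_lt_pi hη0 hη2
    rw [hah, Real.cot_eq_cos_div_sin]
    have : η₁ / √μ₂ * (Real.cos η₁ / Real.sin η₁) = -(γ / ((β - 1) * √μ)) := by
      rw [Real.tan_eq_sin_div_cos] at hroot
      field_simp at hroot ⊢
      linarith
    rw [this]
    linarith
  obtain ⟨D, hD0, hD⟩ := ILW.decay_sharp_rate hκ0 hμ₂ hC h.memH1_ν.2.choose hinv hqν hM
    (fun δ hδ => h.memH1_ν.exists_abs_le hδ) (a := η₁ / √μ₂) (by positivity)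
    (by rw [hah]; exact hη2) hF
  have hmul : ∀ᵐ x, Real.exp (η₁ / √μ₂ * |x|) * |ν x| ≤ D := by
    filter_upwards [hD] with x hx
    calc Real.exp (η₁ / √μ₂ * |x|) * |ν x|
        ≤ Real.exp (η₁ / √μ₂ * |x|) * (D * Real.exp (-(η₁ / √μ₂) * |x|)) := by gcongr
      _ = D * Real.exp (η₁ / √μ₂ * |x| + -(η₁ / √μ₂) * |x|) := by rw [Real.exp_add]; ring
      _ = D := by rw [neg_mul, add_neg_cancel, Real.exp_zero, mul_one]
  have hνc := h.memH1_ν.1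
  have hall : ∀ x, Real.exp (η₁ / √μ₂ * |x|) * |ν x| ≤ D := by
    have hcl : IsClosed {x | Real.exp (η₁ / √μ₂ * |x|) * |ν x| ≤ D} :=
      isClosed_le (by fun_prop) continuous_const
    have hdense : Dense {x | Real.exp (η₁ / √μ₂ * |x|) * |ν x| ≤ D} :=
      MeasureTheory.Measure.dense_of_ae hmul
    exact fun x => (hcl.closure_eq ▸ hdense.closure_eq ▸ Set.mem_univ x :)
  refine ⟨(C' + 1) * D + 1, by positivity, fun x => ⟨?_, ?_⟩⟩
  · calc Real.exp (η₁ / √μ₂ * |x|) * |ξ x| ≤ Real.exp (η₁ / √μ₂ * |x|) * (C' * |ν x|) := by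
          gcongr; exact hξν x
      _ = C' * (Real.exp (η₁ / √μ₂ * |x|) * |ν x|) := by ring
      _ ≤ C' * D := by gcongr; exact hall x
      _ ≤ (C' + 1) * D + 1 := by linarith
  · have := mul_nonneg hC' hD0
    linarith [hall x]
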